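/- **Model.** The network is a connected undirected graph $G=(V,E_G)$ with $n$ vertices and maximum degree at most $\Delta$; each vertex hosts an anonymous device that knows $n$, $\Delta$, its own input, and a private infinite sequence of independent fair random bits. Time is divided into synchronized slots. In each slot a device may send a message (a finite bit string of any length), listen, or stay idle; a full-duplex device may also send and listen in the same slot. The energy of a device is the number of slots in which it sends or listens. In $\mathsf{LOCAL}$ a listener hears all messages sent by its neighbors. In $\mathsf{No}\text{-}\mathsf{CD}$ a listener hears the message if exactly one neighbor sends, and silence otherwise. The graph $G+G^2$ joins any two distinct vertices at distance at most $2$ in $G$. **Theorem.** For every $c\in\mathbb N$ there is a constant $C>0$, depending only on $c$, such that the following holds for all $n$ and $\Delta$. (1) There is a number $T_0\le C\,\Delta\log\Delta\log n$ and a randomized $\mathsf{No}\text{-}\mathsf{CD}$ protocol $\mathcal P$, never sending and listening in the same slot, such that if $\Delta\ge 2$, then on every such network $\mathcal P$ computes in $T_0$ slots, with probability at least $1-n^{-c}$, a proper coloring of $G+G^2$ with $2\Delta^2$ colors. (2) Let $\mathcal A$ be any (deterministic or randomized, possibly full-duplex) $\mathsf{LOCAL}$ algorithm, and let $T,E\in\mathbb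 N$ be bounds for its time and for its energy per device. Then there is a randomized $\mathsf{No}\text{-}\mathsf{CD}$ protocol $\mathcal S$, never sending and listening in the same slot, that begins by running $\mathcal P$ for its first $T_0$ slots, always takes at most $$C\,(\Delta^2T+\Delta\log\Delta\log n)$$ slots, and in which every device always spends energy at most $$C\,\Delta\,(E+\log\Delta\log n),$$ and $\mathcal S$ simulates $\mathcal A$ in the following sense. In $\mathcal S$ each device obtains from its random bits, by the same rule for all devices, a sequence of independent fair bits that serves as its random bits for $\mathcal A$, and a second such sequence, independent of the first, that serves as its random bits for $\mathcal P$. For every network and every assignment of inputs, except with probability at most $n^{-c}$, the following holds: if in the execution of $\mathcal A$ for $T$ slots with these random bits no device spends more than $E$ energy, then every device outputs in $\mathcal S$ exactly what it outputs in that execution of $\mathcal A$. -/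

import Mathlib

open MeasureTheory

/-! ## Devices, channels and protocols -/

/-- A message is a finite bit string; its length is unrestricted. -/
abbrev Message : Type := List Bool

/-- The private random bits of one device. -/
abbrev Tape : Type := ℕ → Bool

/-- The law of one tape: independent fair coin flips. -/
noncomputable def tapeMeasure : Measure Tape :=
  Measure.infinitePi (fun _ : ℕ => (PMF.uniformOfFintype Bool).toMeasure)

instance : IsProbabilityMeasure tapeMeasure := by
  unfold tapeMeasure; infer_instance

/-- The joint law of the tapes of all devices: the tapes are independent. -/
noncomputable def tapesMeasure (V : Type*) [Fintype V] : Measure (V → Tape) :=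
  Measure.pi (fun _ : V => tapeMeasure)

/-- What a device does in one time slot: the message it transmits, if any, and whether it listens.
Idle is `⟨none, false⟩`; the combination `⟨some m, true⟩` is possible for full-duplex
devices only. -/
structure SlotAction where
  send : Option Message
  listen : Bool

instance : MeasurableSpace SlotAction := ⊤

/-- Energy is charged for every slot in which the device transmits or listens (one unit, also if
it does both). -/
def SlotAction.Active (a : SlotAction) : Prop := a.send.isSome = true ∨ a.listen = true

/-- A collision model: what a listener hears, as a function of the multiset of the messages that
its neighbours transmit in the same slot. -/
structure Channel where
  Feedback : Type
  hear : Multiset Message → Feedback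

/-- `LOCAL`: a listener hears every message transmitted by any neighbour. -/
abbrev LOCAL : Channel where
  Feedback := Multiset Message
  hear := fun s => s

open Classical in
/-- `No-CD`: a listener receives the message `m` (feedback `some m`) if exactly one neighbour
transmits; if no neighbour or at least two neighbours transmit, it hears silence (`none`). -/
noncomputable abbrev NoCD : Channel where
  Feedback := Option Message
  hear := fun s => if h : ∃ m, s = {m} then some h.choose else none

theorem NoCD_hear_singleton (m : Message) : NoCD.hear {m} = some m := by
  have h : ∃ m', ({m} : Multiset Message) = {m'} := ⟨m, rfl⟩
  have h2 : h.choose = m := (Multiset.singleton_inj.mp h.choose_spec).symm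
  simp only [NoCD]
  rw [dif_pos h, h2]

theorem NoCD_hear_of_card_ne_one (s : Multiset Message) (hs : s.card ≠ 1) :
    NoCD.hear s = none := by
  have h : ¬ ∃ m, s = {m} := by
    rintro ⟨m, rfl⟩
    exact hs (Multiset.card_singleton m)
  simp only [NoCD]
  rw [dif_neg h]

/-- A randomized protocol over the channel `ch`, executed by every device.  A device knows its own
input in `I`, its own tape, and what it has perceived so far: a list, in chronological order, with
one entry per elapsed slot, `none` if it did not listen in that slot and `some f` if it listened
and the channel gave the feedback `f`.  From these it determines its action in the current slot
(whose number is the length of the list) and, when the execution is over, its output.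
Everything is a measurable function of the tape. -/
structure Protocol (ch : Channel) (I O : Type*) [MeasurableSpace O] where
  act : I → Tape → List (Option ch.Feedback) → SlotAction
  output : I → Tape → List (Option ch.Feedback) → O
  measurable_act : ∀ x h, Measurable (fun r => act x r h)
  measurable_output : ∀ x h, Measurable (fun r => output x r h)

namespace Protocol

variable {ch : Channel} {I O : Type*} [MeasurableSpace O] {V : Type*} [Fintype V]

/-- The protocol never transmits and listens in the same slot. -/
def HalfDuplex (A : Protocol ch I O) : Prop :=
  ∀ x r h, ¬ ((A.act x r h).send.isSome = true ∧ (A.act x r h).listen = true)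

open Classical in
/-- The messages that the neighbours of `v` transmit, when the devices act according to `a`. -/
noncomputable def incoming (G : SimpleGraph V) (a : V → SlotAction) (v : V) : Multiset Message :=
  (Finset.univ.filter (fun w => G.Adj v w)).val.filterMap (fun w => (a w).send)

/-- What `v` has perceived in the first `t` slots of the execution on the network `G`, with inputs
`x` and tapes `r`. -/
noncomputable def history (A : Protocol ch I O) (G : SimpleGraph V) (x : V → I) (r : V → Tape) :
    ℕ → V → List (Option ch.Feedback)
  | 0, _ => []
  | t + 1, v => history A G x r t v ++
      [if (A.act (x v) (r v) (history A G x r t v)).listen then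
        some (ch.hear
          (incoming G (fun w => A.act (x w) (r w) (history A G x r t w)) v))
      else none]

/-- The action of `v` in slot `t` (slots are numbered from `0`). -/
noncomputable def action (A : Protocol ch I O) (G : SimpleGraph V) (x : V → I) (r : V → Tape)
    (t : ℕ) (v : V) : SlotAction :=
  A.act (x v) (r v) (A.history G x r t v)

open Classical in
/-- The energy that `v` spends in the first `T` slots. -/
noncomputable def energy (A : Protocol ch I O) (G : SimpleGraph V) (x : V → I) (r : V → Tape)
    (T : ℕ) (v : V) : ℕ :=
  ((Finset.range T).filter (fun t => (A.action G x r t v).Active)).card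

/-- The output of `v` when the execution lasts `T` slots. -/
noncomputable def result (A : Protocol ch I O) (G : SimpleGraph V) (x : V → I) (r : V → Tape)
    (T : ℕ) (v : V) : O :=
  A.output (x v) (r v) (A.history G x r T v)

end Protocol

/-! ## Networks and colorings -/

open Classical in
/-- The networks under consideration: connected graphs of maximum degree at most `Δ`. -/
def IsNetwork {V : Type*} [Fintype V] (Δ : ℕ) (G : SimpleGraph V) : Prop :=
  G.Connected ∧ ∀ v, G.degree v ≤ Δ

/-- The graph `G + G²`: distinct vertices are adjacent iff their distance in `G` is at most 2. -/
def plusSquare {V : Type*} (G : SimpleGraph V) : SimpleGraph V where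
  Adj u v := u ≠ v ∧ (G.Adj u v ∨ ∃ w, G.Adj u w ∧ G.Adj w v)
  symm := by
    constructor
    rintro u v ⟨hne, h | ⟨w, h1, h2⟩⟩
    · exact ⟨hne.symm, Or.inl h.symm⟩
    · exact ⟨hne.symm, Or.inr ⟨w, h2.symm, h1.symm⟩⟩
  loopless := by
    constructor
    rintro u ⟨hne, _⟩
    exact hne rfl

/-- `col` is a proper coloring of `H` with the colors `0, …, k - 1`. -/
def IsColoring {V : Type*} (H : SimpleGraph V) (k : ℕ) (col : V → ℕ) : Prop :=
  (∀ v, col v < k) ∧ ∀ u v, H.Adj u v → col u ≠ col v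

/-! The simulation is time division. Given a proper coloring of `G + G²`, each slot of the `LOCAL`
algorithm becomes one subslot per color, and a device sends only in the subslot of its own color.
The neighbours of a device have pairwise distinct colors, all different from its own, so a listener
meets no collision and no device has to send and listen at once (`filterMap_subslots`). A device
that knows a list of at most `O(Δ)` colors containing those of its neighbours listens only in these
subslots, so an active slot costs `O(Δ)` energy. A device falls silent once its simulated energy
exceeds `E`, so the energy bound holds on every execution (`card_active_le`,
`simulation_energy_le`); if `A` respects its budget, this never happens and the outputs agree
(`simulation_correct`).

The coloring is found by repeated random trials. If every device sends its whole state with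
probability `1 / D`, where `2Δ ≤ D ≤ 4Δ`, a given neighbour is heard in a slot with probability at
least `1 / (2D)` (`expect_not_mem_exchange_le`), so `2Dm` slots lose a given message with
probability at most `2⁻ᵐ`. After random identifiers have been exchanged, each phase lets the
unfinished devices draw candidates among `2Δ²` colors. At most `Δ²` vertices compete with a given
one, so a conflict has probability little more than `1 / 2`. Two exchanges with `m = O(log Δ)` carry
the candidates to distance two. A device thus finishes in a phase with probability at least `1 / 4`
(`wp_phase_le`), and `O(log n)` phases suffice for all devices. Once the identifiers are known, lost
messages can delay a device but never spoil the coloring, because `Check` passes only on complete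
information (`col_ne_of_check`).

Probabilities are computed as iterated finite averages `wp`; `tapesMeasure_exec` identifies these
with measures of events on tapes. -/

section Protocols

open scoped BigOperators

section Tapes

/-! ## Splitting tapes -/

/-- One half of the bits of a tape. -/
def tapeFst (r : Tape) : Tape := fun k => r (Equiv.boolProdNatEquivNat (false, k))

/-- The other half of the bits of a tape. -/
def tapeSnd (r : Tape) : Tape := fun k => r (Equiv.boolProdNatEquivNat (true, k))

theorem measurable_tapeFst : Measurable tapeFst := by
  unfold tapeFst; fun_prop

theorem measurable_tapeSnd : Measurable tapeSnd := by
  unfold tapeSnd; fun_prop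

/-- Reindexing the bits by `Bool × ℕ` and currying turns a tape into an independent family of two
tapes; its two coordinates are the two halves. -/
theorem measurePreserving_tapeSplit :
    MeasurePreserving (fun r => (tapeFst r, tapeSnd r)) tapeMeasure
      (tapeMeasure.prod tapeMeasure) := by
  refine ⟨measurable_tapeFst.prodMk measurable_tapeSnd, ?_⟩
  set β : Measure Bool := (PMF.uniformOfFintype Bool).toMeasure with hβ
  have h1 := Measure.infinitePi_map_piCongrLeft (X := fun _ : Bool × ℕ => Bool) (fun _ => β)
    Equiv.boolProdNatEquivNat.symm
  have h2 := Measure.infinitePi_map_curry (ι := Bool) (κ := ℕ) (fun _ _ => β)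
  have h3 := Measure.infinitePi_map_eval_prod (Ω := fun _ : Bool => Tape)
    (P := fun _ => tapeMeasure) (i := false) (j := true) (by decide)
  rw [← h3]
  change _ = Measure.map _ (Measure.infinitePi fun _ : Bool => Measure.infinitePi fun _ : ℕ => β)
  rw [← h2, ← h1, Measure.map_map (by fun_prop) (by fun_prop),
    Measure.map_map (by fun_prop) (by fun_prop)]
  congr 1
  funext r
  have h4 (p : Bool × ℕ) : Equiv.piCongrLeft (fun _ => Bool) Equiv.boolProdNatEquivNat.symm r p =
      r (Equiv.boolProdNatEquivNat p) := by
    obtain ⟨k, rfl⟩ := Equiv.boolProdNatEquivNat.symm.surjective p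
    rw [Equiv.piCongrLeft_apply_apply, Equiv.apply_symm_apply]
  simp only [Function.comp_apply, MeasurableEquiv.curry, MeasurableEquiv.coe_mk,
    MeasurableEquiv.coe_piCongrLeft]
  exact Prod.ext (funext fun k => (h4 (false, k)).symm) (funext fun k => (h4 (true, k)).symm)

variable {V : Type*} [Fintype V]

instance : IsProbabilityMeasure (tapesMeasure V) := by
  unfold tapesMeasure; infer_instance

theorem measurePreserving_tapesSplit :
    MeasurePreserving
      (fun r : V → Tape => ((fun v => tapeFst (r v)), (fun v => tapeSnd (r v))))
      (tapesMeasure V) ((tapesMeasure V).prod (tapesMeasure V)) :=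
  (measurePreserving_arrowProdEquivProdArrow Tape Tape V (fun _ => tapeMeasure)
    (fun _ => tapeMeasure)).comp
    (measurePreserving_pi (fun _ => tapeMeasure) _ fun _ => measurePreserving_tapeSplit)

theorem measurePreserving_tapesSnd :
    MeasurePreserving (fun (r : V → Tape) v => tapeSnd (r v)) (tapesMeasure V) (tapesMeasure V) :=
  measurePreserving_snd.comp measurePreserving_tapesSplit

/-! ## Uniform samples -/

/-- A uniform sample obtained from the first `b` bits of a tape. -/
noncomputable def sample (b : ℕ) (r : Tape) : Fin (2 ^ b) :=
  (Fintype.equivFinOfCardEq (by simp : Fintype.card (Fin b → Bool) = 2 ^ b)) (fun i => r i)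

theorem measurable_sample (b : ℕ) : Measurable (sample b) := by
  unfold sample
  exact (measurable_of_finite _).comp (by fun_prop)

theorem tapeMeasure_sample (b : ℕ) (y : Fin (2 ^ b)) :
    tapeMeasure {r | sample b r = y} = ((2 : ENNReal) ^ b)⁻¹ := by
  set e := Fintype.equivFinOfCardEq (by simp : Fintype.card (Fin b → Bool) = 2 ^ b)
  have h1 : {r | sample b r = y} =
      Set.pi (Finset.range b) (fun i => if h : i < b then {e.symm y ⟨i, h⟩} else Set.univ) := by
    ext r
    simp only [sample, Set.mem_ofPred_eq, Set.mem_pi, Finset.coe_range, Set.mem_Iio]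
    rw [← Equiv.eq_symm_apply, funext_iff]
    constructor
    · intro h i hi
      simp [hi, e, ← h ⟨i, hi⟩]
    · intro h i
      simpa [i.2] using h i i.2
  rw [h1, tapeMeasure, Measure.infinitePi_pi]
  · rw [Finset.prod_congr rfl (g := fun _ => (2 : ENNReal)⁻¹), Finset.prod_const,
      Finset.card_range, ENNReal.inv_pow]
    intro i hi
    rw [dif_pos (Finset.mem_range.mp hi), PMF.toMeasure_apply_singleton _ _ (by simp)]
    simp
  · intro i _
    exact MeasurableSet.of_discrete

theorem tapesMeasure_sample [DecidableEq V] (b : ℕ) (x : V → Fin (2 ^ b)) :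
    tapesMeasure V {r | (fun v => sample b (r v)) = x} =
      (Fintype.card (V → Fin (2 ^ b)) : ENNReal)⁻¹ := by
  have h1 : {r : V → Tape | (fun v => sample b (r v)) = x} =
      Set.pi Set.univ (fun v => {r | sample b r = x v}) := by
    ext r; simp [funext_iff]
  rw [h1, tapesMeasure, Measure.pi_pi]
  simp only [tapeMeasure_sample, Finset.prod_const, Finset.card_univ, Fintype.card_fun,
    Fintype.card_fin]
  push_cast
  simp only [ENNReal.inv_pow]

/-! ## Programs and their weakest pre-expectations -/

section Programs

variable {S X : Type*}

/-- `Q` holds surely after the randomized transitions `p`, started in `s`. -/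
def Surely (p : List (S → X → S)) (Q : S → Prop) : S → Prop :=
  p.foldr (fun i g s => ∀ x, g (i s x)) Q

@[simp] theorem surely_nil (Q : S → Prop) (s : S) :
    Surely ([] : List (S → X → S)) Q s ↔ Q s := Iff.rfl

@[simp] theorem surely_cons (i : S → X → S) (p : List (S → X → S)) (Q : S → Prop) (s : S) :
    Surely (i :: p) Q s ↔ ∀ x, Surely p Q (i s x) := Iff.rfl

theorem surely_append (p q : List (S → X → S)) (Q : S → Prop) (s : S) :
    Surely (p ++ q) Q s ↔ Surely p (Surely q Q) s := by
  simp [Surely]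

theorem Surely.mono {p : List (S → X → S)} {Q R : S → Prop} {s : S} (h : Surely p Q s)
    (hQR : ∀ s, Q s → R s) : Surely p R s := by
  induction p generalizing s with
  | nil => exact hQR s h
  | cons i p ih => exact fun x => ih (h x)

theorem surely_of_invariant {p : List (S → X → S)} {Q : S → Prop} {s : S} (hs : Q s)
    (h : ∀ i ∈ p, ∀ s x, Q s → Q (i s x)) : Surely p Q s := by
  induction p generalizing s with
  | nil => exact hs
  | cons i p ih =>
    exact fun x => ih (h i (by simp) s x hs) fun j hj => h j (by simp [hj])

theorem surely_flatten_replicate {p : List (S → X → S)} {Q : S → Prop} {s : S} (hs : Q s)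
    (h : ∀ s, Q s → Surely p Q s) (k : ℕ) : Surely (List.replicate k p).flatten Q s := by
  induction k generalizing s with
  | zero => simpa using hs
  | succ k ih =>
    rw [List.replicate_succ, List.flatten_cons, surely_append]
    exact (h s hs).mono fun s hs => ih hs

variable [Fintype X]

/-- The expectation of `f` after the randomized transitions `p`, started in `s`. -/
noncomputable def wp (p : List (S → X → S)) (f : S → ℝ) : S → ℝ :=
  p.foldr (fun i g s => 𝔼 x, g (i s x)) f

@[simp] theorem wp_nil (f : S → ℝ) (s : S) : wp ([] : List (S → X → S)) f s = f s := rfl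

@[simp] theorem wp_cons (i : S → X → S) (p : List (S → X → S)) (f : S → ℝ) (s : S) :
    wp (i :: p) f s = 𝔼 x, wp p f (i s x) := rfl

theorem wp_append (p q : List (S → X → S)) (f : S → ℝ) (s : S) :
    wp (p ++ q) f s = wp p (wp q f) s := by
  simp [wp]

/-- Combines sure and probabilistic reasoning: the functions are compared only where the sure
postcondition `Q` holds. -/
theorem wp_le_wp {p : List (S → X → S)} {f g : S → ℝ} {Q : S → Prop} {s : S}
    (hs : Surely p Q s) (h : ∀ s, Q s → f s ≤ g s) : wp p f s ≤ wp p g s := by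
  induction p generalizing s with
  | nil => exact h s hs
  | cons i p ih => exact Finset.expect_le_expect fun x _ => ih (hs x)

theorem wp_mono {p : List (S → X → S)} {f g : S → ℝ} (h : ∀ s, f s ≤ g s) (s : S) :
    wp p f s ≤ wp p g s :=
  wp_le_wp (Q := fun _ => True) (surely_of_invariant trivial fun _ _ _ _ _ => trivial)
    fun s _ => h s

theorem wp_add (p : List (S → X → S)) (f g : S → ℝ) (s : S) :
    wp p (fun s => f s + g s) s = wp p f s + wp p g s := by
  induction p generalizing s with
  | nil => rfl
  | cons i p ih => simp [ih, Finset.expect_add_distrib]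

theorem wp_mul (p : List (S → X → S)) (a : ℝ) (f : S → ℝ) (s : S) :
    wp p (fun s => a * f s) s = a * wp p f s := by
  induction p generalizing s with
  | nil => rfl
  | cons i p ih => simp [ih, Finset.mul_expect]

theorem wp_sum {ι : Type*} (t : Finset ι) (p : List (S → X → S)) (f : ι → S → ℝ) (s : S) :
    wp p (fun s => ∑ i ∈ t, f i s) s = ∑ i ∈ t, wp p (f i) s := by
  induction p generalizing s with
  | nil => rfl
  | cons i p ih => simp [ih, Finset.expect_sum_comm]

theorem wp_const [Nonempty X] (p : List (S → X → S)) (a : ℝ) (s : S) :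
    wp p (fun _ => a) s = a := by
  induction p generalizing s with
  | nil => rfl
  | cons i p ih => simp [ih]

theorem wp_le_const [Nonempty X] {p : List (S → X → S)} {f : S → ℝ} {Q : S → Prop} {s : S}
    {a : ℝ} (hs : Surely p Q s) (h : ∀ s, Q s → f s ≤ a) : wp p f s ≤ a :=
  (wp_le_wp hs h).trans_eq (wp_const p a s)

theorem wp_nonneg {p : List (S → X → S)} {f : S → ℝ} (h : ∀ s, 0 ≤ f s) (s : S) :
    0 ≤ wp p f s := by
  induction p generalizing s with
  | nil => exact h s
  | cons i p ih => exact Finset.expect_nonneg fun x _ => ih _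

open Classical in
/-- The indicator function of a predicate. -/
noncomputable def ind (B : S → Prop) (s : S) : ℝ := if B s then 1 else 0

theorem ind_nonneg (B : S → Prop) (s : S) : 0 ≤ ind B s := by
  unfold ind; split_ifs <;> norm_num

theorem ind_le_one (B : S → Prop) (s : S) : ind B s ≤ 1 := by
  unfold ind; split_ifs <;> norm_num

theorem ind_of {B : S → Prop} {s : S} (h : B s) : ind B s = 1 := if_pos h

theorem ind_of_not {B : S → Prop} {s : S} (h : ¬ B s) : ind B s = 0 := if_neg h

theorem ind_exists_le {ι : Type*} (t : Finset ι) (B : ι → S → Prop) (s : S) :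
    ind (fun s => ∃ i ∈ t, B i s) s ≤ ∑ i ∈ t, ind (B i) s := by
  by_cases h : ∃ i ∈ t, B i s
  · rw [ind_of (B := fun s => ∃ i ∈ t, B i s) h]
    obtain ⟨i, hi, hb⟩ := h
    rw [← ind_of hb]
    exact Finset.single_le_sum (f := fun i => ind (B i) s) (fun j _ => ind_nonneg _ _) hi
  · rw [ind_of_not (B := fun s => ∃ i ∈ t, B i s) h]
    exact Finset.sum_nonneg fun j _ => ind_nonneg _ _

/-- The union bound. -/
theorem wp_ind_exists_le {ι : Type*} (t : Finset ι) (p : List (S → X → S)) (B : ι → S → Prop)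
    (s : S) {a : ℝ} (h : ∀ i ∈ t, wp p (ind (B i)) s ≤ a) :
    wp p (ind fun s => ∃ i ∈ t, B i s) s ≤ t.card * a := by
  refine (wp_mono (ind_exists_le t B) s).trans ?_
  rw [wp_sum, ← nsmul_eq_mul]
  exact Finset.sum_le_card_nsmul _ _ _ h

end Programs

/-! ## Programs driven by tapes -/

section Exec

variable {S : Type*} {b : ℕ}

/-- The state after the randomized transitions `p`, driven by the tapes `r`: each transition
takes its samples from one half of the remaining bits. -/
noncomputable def exec : List (S → (V → Fin (2 ^ b)) → S) → S → (V → Tape) → S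
  | [], s, _ => s
  | i :: p, s, r =>
    exec p (i s fun v => sample b (tapeFst (r v))) (fun v => tapeSnd (r v))

theorem measurable_sampleFst {V : Type*} :
    Measurable fun (r : V → Tape) v => sample b (tapeFst (r v)) :=
  measurable_pi_lambda _ fun v =>
    ((measurable_sample b).comp measurable_tapeFst).comp (measurable_pi_apply v)

theorem measurableSet_exec (p : List (S → (V → Fin (2 ^ b)) → S)) (B : S → Prop) (s : S) :
    MeasurableSet {r | B (exec p s r)} := by
  induction p generalizing s with
  | nil => exact MeasurableSet.const (B s)
  | cons i p ih =>
    have h1 : {r | B (exec (i :: p) s r)} =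
        ⋃ x, {r : V → Tape | (fun v => sample b (tapeFst (r v))) = x} ∩
          (fun (r : V → Tape) v => tapeSnd (r v)) ⁻¹' {r | B (exec p (i s x) r)} := by
      ext r; simp [exec]
    rw [h1]
    refine MeasurableSet.iUnion fun x => MeasurableSet.inter ?_ ?_
    · exact measurable_sampleFst (MeasurableSet.singleton x)
    · exact measurePreserving_tapesSnd.measurable (ih _)

/-- The bridge from tapes to finite averages. The event splits according to the first joint sample,
which is uniform and independent of the remaining bits. -/
theorem tapesMeasure_exec [DecidableEq V] (p : List (S → (V → Fin (2 ^ b)) → S)) (B : S → Prop) (s : S) :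
    tapesMeasure V {r | B (exec p s r)} = ENNReal.ofReal (wp p (ind B) s) := by
  induction p generalizing s with
  | nil =>
    by_cases h : B s
    · simp [exec, h, ind]
    · simp [exec, h, ind]
  | cons i p ih =>
    have h1 : {r | B (exec (i :: p) s r)} =
        ⋃ x ∈ (Finset.univ : Finset (V → Fin (2 ^ b))),
          (fun r : V → Tape => ((fun v => tapeFst (r v)), (fun v => tapeSnd (r v)))) ⁻¹'
          ({r | (fun v => sample b (r v)) = x} ×ˢ {r | B (exec p (i s x) r)}) := by
      ext r; simp [exec]
    have hm (x : V → Fin (2 ^ b)) : MeasurableSet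
        {r : V → Tape | (fun v => sample b (r v)) = x} :=
      (measurable_pi_lambda _ fun v => (measurable_sample b).comp (measurable_pi_apply v))
        (MeasurableSet.singleton x)
    rw [h1, measure_biUnion_finset]
    · have h2 (x : V → Fin (2 ^ b)) : tapesMeasure V
          ((fun r : V → Tape => ((fun v => tapeFst (r v)), (fun v => tapeSnd (r v)))) ⁻¹'
            ({r | (fun v => sample b (r v)) = x} ×ˢ {r | B (exec p (i s x) r)})) =
          ENNReal.ofReal ((Fintype.card (V → Fin (2 ^ b)) : ℝ)⁻¹ * wp p (ind B) (i s x)) := by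
        rw [measurePreserving_tapesSplit.measure_preimage
          ((hm x).prod (measurableSet_exec _ _ _)).nullMeasurableSet, Measure.prod_prod, ih,
          tapesMeasure_sample, ENNReal.ofReal_mul (by positivity),
          ENNReal.ofReal_inv_of_pos (by exact_mod_cast Fintype.card_pos)]
        simp
      rw [Finset.sum_congr rfl fun x _ => h2 x, ← ENNReal.ofReal_sum_of_nonneg, wp_cons,
        Fintype.expect_eq_sum_div_card, ← Finset.mul_sum, div_eq_inv_mul]
      intro x _
      exact mul_nonneg (by positivity) (wp_nonneg (ind_nonneg B) _)
    · intro x _ y _ hxy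
      rw [Function.onFun, Set.disjoint_left]
      rintro r ⟨h, _⟩ ⟨h', _⟩
      exact hxy (h.symm.trans h')
    · intro x _
      exact measurePreserving_tapesSplit.measurable ((hm x).prod (measurableSet_exec _ _ _))

end Exec

end Tapes

/-! ## Protocols given by programs -/

/-- One slot of a program for a device with state space `σ`: the action and the new state depend
on the state, on a uniform sample, and (the new state) on what is perceived in the slot. -/
structure ProgramSlot (σ : Type*) (b : ℕ) where
  act : σ → Fin (2 ^ b) → SlotAction
  upd : σ → Fin (2 ^ b) → Option (Option Message) → σ
  halfDuplex : ∀ s x, ¬ ((act s x).send.isSome = true ∧ (act s x).listen = true)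

/-- A configuration: the remaining program, the state, and the unused bits. -/
abbrev Conf (σ : Type*) (b : ℕ) : Type _ := List (ProgramSlot σ b) × σ × Tape

namespace Conf

variable {σ : Type*} {b : ℕ}

/-- The action of a device in a given configuration. -/
noncomputable def act : Conf σ b → SlotAction
  | ([], _, _) => ⟨none, false⟩
  | (i :: _, s, r) => i.act s (sample b (tapeFst r))

/-- The next configuration. -/
noncomputable def next : Conf σ b → Option (Option Message) → Conf σ b
  | ([], s, r), _ => ([], s, r)
  | (i :: p, s, r), f => (p, i.upd s (sample b (tapeFst r)) f, tapeSnd r)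

theorem act_halfDuplex (c : Conf σ b) :
    ¬ (c.act.send.isSome = true ∧ c.act.listen = true) := by
  match c with
  | ([], _, _) => simp [act]
  | (i :: _, s, r) => exact i.halfDuplex _ _

/-- A transition uses the tape only through a sample with finitely many values and through the
unused half, so it suffices to fix the sample and argue about the rest. -/
theorem measurable_foldl_next {β : Type*} [MeasurableSpace β] {F : Conf σ b → β}
    (hF : ∀ p s, Measurable fun r => F (p, s, r)) (h : List (Option (Option Message)))
    (p : List (ProgramSlot σ b)) (s : σ) :
    Measurable fun r => F (h.foldl next (p, s, r)) := by
  induction h generalizing p s with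
  | nil => exact hF p s
  | cons f h ih =>
    match p with
    | [] => exact ih [] s
    | i :: p =>
      have h1 : Measurable fun q : Fin (2 ^ b) × Tape =>
          F (h.foldl next (p, i.upd s q.1 f, q.2)) :=
        measurable_from_prod_countable_right fun y => ih p (i.upd s y f)
      exact h1.comp (((measurable_sample b).comp measurable_tapeFst).prodMk measurable_tapeSnd)

theorem measurable_act (p : List (ProgramSlot σ b)) (s : σ) :
    Measurable fun r => act (p, s, r) := by
  match p with
  | [] => exact measurable_const
  | i :: p =>
    exact (measurable_of_countable (fun x => i.act s x)).comp
      ((measurable_sample b).comp measurable_tapeFst)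

end Conf

/-- The protocol that executes a program from a given initial state. -/
noncomputable def programProtocol {σ O : Type*} {b : ℕ} [MeasurableSpace O]
    (p : List (ProgramSlot σ b)) (s : σ) (out : σ → O) : Protocol NoCD Unit O where
  act _ r h := (h.foldl Conf.next (p, s, r)).act
  output _ r h := out (h.foldl Conf.next (p, s, r)).2.1
  measurable_act _ h := Conf.measurable_foldl_next Conf.measurable_act h p s
  measurable_output _ h :=
    Conf.measurable_foldl_next (F := fun c => out c.2.1) (fun _ s => measurable_const (a := out s))
      h p s

theorem programProtocol_halfDuplex {σ O : Type*} {b : ℕ} [MeasurableSpace O]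
    (p : List (ProgramSlot σ b)) (s : σ) (out : σ → O) :
    (programProtocol p s out).HalfDuplex := by
  intro x r h
  exact Conf.act_halfDuplex _

section Global

variable {V : Type*} [Fintype V] {σ : Type*} {b : ℕ}

/-- What `v` perceives when the devices act according to `a`. -/
noncomputable def perceive (G : SimpleGraph V) (a : V → SlotAction) (v : V) :
    Option (Option Message) :=
  if (a v).listen then some (NoCD.hear (Protocol.incoming G a v)) else none

/-- The joint transition of all devices in a slot of a program. -/
noncomputable def globalSlot (G : SimpleGraph V) (i : ProgramSlot σ b) (s : V → σ)
    (x : V → Fin (2 ^ b)) (v : V) : σ :=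
  i.upd (s v) (x v) (perceive G (fun w => i.act (s w) (x w)) v)

/-- The joint transition of all configurations. -/
noncomputable def globalNext (G : SimpleGraph V) (c : V → Conf σ b) (v : V) : Conf σ b :=
  (c v).next (perceive G (fun w => (c w).act) v)

theorem globalNext_iterate (G : SimpleGraph V) (p : List (ProgramSlot σ b)) (s : V → σ)
    (r : V → Tape) (v : V) :
    ((globalNext G)^[p.length] (fun w => (p, s w, r w)) v).2.1 =
      exec (p.map (globalSlot G)) s r v := by
  induction p generalizing s r with
  | nil => rfl
  | cons i p ih => exact ih _ _

/-- A device sees only its tape and its history; folding over the history recomputes its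
configuration, in step with the joint evolution of all devices. -/
theorem foldl_history {O : Type*} [MeasurableSpace O] (G : SimpleGraph V)
    (p : List (ProgramSlot σ b)) (s : σ) (out : σ → O) (r : V → Tape) (t : ℕ) (v : V) :
    ((programProtocol p s out).history G (fun _ => ()) r t v).foldl Conf.next (p, s, r v) =
      (globalNext G)^[t] (fun w => (p, s, r w)) v := by
  induction t generalizing v with
  | zero => rfl
  | succ t ih =>
    rw [Function.iterate_succ_apply', Protocol.history, List.foldl_append, ih]
    simp only [List.foldl_cons, List.foldl_nil]
    rw [globalNext]
    congr 1
    have ha : (fun w => (programProtocol p s out).act () (r w)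
        ((programProtocol p s out).history G (fun _ => ()) r t w)) =
        fun w => ((globalNext G)^[t] (fun w => (p, s, r w)) w).act :=
      funext fun w => congrArg Conf.act (ih w)
    exact congrArg (fun a => perceive G a v) ha

theorem programProtocol_result {O : Type*} [MeasurableSpace O] (G : SimpleGraph V)
    (p : List (ProgramSlot σ b)) (s : σ) (out : σ → O) (r : V → Tape) (v : V) :
    (programProtocol p s out).result G (fun _ => ()) r p.length v =
      out (exec (p.map (globalSlot G)) (fun _ => s) r v) := by
  rw [← globalNext_iterate, ← foldl_history G p s out]
  rfl

end Global

/-! ## Full-information rounds -/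

section Rounds

variable {κ : Type*} [Encodable κ] {b : ℕ}

/-- The state of a device as a message. -/
def encodeMessage (k : κ) : Message := List.replicate (Encodable.encode k) true

/-- The inverse of `encodeMessage`. -/
def decodeMessage (m : Message) : Option κ := Encodable.decode m.length

theorem decodeMessage_encodeMessage (k : κ) : decodeMessage (encodeMessage k) = some k := by
  simp [decodeMessage, encodeMessage]

/-- A slot of local computation: the device updates its state and empties its buffer. -/
def think (g : κ → Finset κ → Fin (2 ^ b) → κ) : ProgramSlot (κ × Finset κ) b where
  act _ _ := ⟨none, false⟩
  upd s x _ := (g s.1 s.2 x, ∅)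
  halfDuplex := by simp

open Classical in
/-- Add the state described by a received message, if any, to a buffer. -/
noncomputable def receive (f : Option (Option Message)) (B : Finset κ) : Finset κ :=
  match (f.join.bind decodeMessage : Option κ) with
  | some k => insert k B
  | none => B

/-- A slot of exchange: the device sends its state with probability `h / 2 ^ b`, and otherwise it
listens and puts what it hears into its buffer. -/
noncomputable def exchange (h : ℕ) : ProgramSlot (κ × Finset κ) b where
  act s x := if x.val < h then ⟨some (encodeMessage s.1), false⟩ else ⟨none, true⟩
  upd s _ f := (s.1, receive f s.2)
  halfDuplex := by
    intro s x
    by_cases hx : x.val < h <;> simp [hx]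

variable {V : Type*} [Fintype V] (G : SimpleGraph V)

theorem globalSlot_think {κ : Type*} (g : κ → Finset κ → Fin (2 ^ b) → κ) (s : V → κ × Finset κ)
    (x : V → Fin (2 ^ b)) :
    globalSlot G (think g) s x = fun v => (g (s v).1 (s v).2 (x v), ∅) := rfl

theorem subset_receive (f : Option (Option Message)) (B : Finset κ) : B ⊆ receive f B := by
  classical
  unfold receive
  split
  · exact Finset.subset_insert _ _
  · exact Finset.Subset.refl _

theorem subset_globalSlot_exchange (h : ℕ) (s : V → κ × Finset κ) (x : V → Fin (2 ^ b)) (v : V) :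
    (s v).2 ⊆ (globalSlot G (exchange h) s x v).2 := subset_receive _ _

/-- Exchanges never produce false information: a collision is heard as silence, and whatever is
heard decodes to the state of the neighbour that sent it. -/
theorem mem_globalSlot_exchange {h : ℕ} {s : V → κ × Finset κ} {x : V → Fin (2 ^ b)} {v : V}
    {k : κ} (hk : k ∈ (globalSlot G (exchange h) s x v).2) :
    k ∈ (s v).2 ∨ ∃ u, G.Adj v u ∧ k = (s u).1 := by
  classical
  simp only [globalSlot, exchange, receive] at hk
  split at hk
  case h_2 => exact Or.inl hk
  case h_1 k' hk' =>
    rw [Finset.mem_insert] at hk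
    refine hk.symm.imp id fun hkk => ?_
    subst hkk
    rw [Option.bind_eq_some_iff] at hk'
    obtain ⟨m, hm, hd⟩ := hk'
    rw [Option.join_eq_some_iff] at hm
    unfold perceive at hm
    split_ifs at hm with hl
    simp only [Option.some.injEq] at hm
    split_ifs at hm with hx
    have hin := hx.choose_spec
    rw [Option.some.injEq] at hm
    rw [hm] at hin
    have hmem := Multiset.mem_singleton_self m
    rw [← hin, Protocol.incoming, Multiset.mem_filterMap] at hmem
    obtain ⟨w, hw, hs⟩ := hmem
    refine ⟨w, by simpa using hw, ?_⟩
    split_ifs at hs with hxw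
    simp only [Option.some.injEq] at hs
    rw [← hs, decodeMessage_encodeMessage] at hd
    exact (Option.some.inj hd).symm

theorem incoming_eq_singleton {a : V → SlotAction} {u v : V} {m : Message} (huv : G.Adj v u)
    (hu : (a u).send = some m) (hw : ∀ w, G.Adj v w → w ≠ u → (a w).send = none) :
    Protocol.incoming G a v = {m} := by
  classical
  unfold Protocol.incoming
  have h1 : (Finset.univ.filter fun w => G.Adj v w) =
      insert u ((Finset.univ.filter fun w => G.Adj v w).erase u) :=
    (Finset.insert_erase (by simpa using huv)).symm
  have h2 : Multiset.filterMap (fun w => (a w).send)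
      ((Finset.univ.filter fun w => G.Adj v w).erase u).val = 0 := by
    refine Multiset.eq_zero_of_forall_notMem fun m' hm' => ?_
    obtain ⟨w, hmem, hs⟩ := (Multiset.mem_filterMap _ _).mp hm'
    have h3 := Finset.mem_erase.mp (Finset.mem_val.mp hmem)
    simp [hw w (Finset.mem_filter.mp h3.2).2 h3.1] at hs
  rw [h1, Finset.insert_val_of_notMem (by simp),
    Multiset.filterMap_cons_some (fun w => (a w).send) _ _ hu, h2]
  rfl

theorem mem_globalSlot_exchange_of_only {h : ℕ} {s : V → κ × Finset κ} {x : V → Fin (2 ^ b)}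
    {u v : V} (huv : G.Adj v u) (hu : (x u).val < h) (hv : h ≤ (x v).val)
    (hw : ∀ w, G.Adj v w → w ≠ u → h ≤ (x w).val) :
    (s u).1 ∈ (globalSlot G (exchange h) s x v).2 := by
  have h1 := incoming_eq_singleton G (a := fun w => (exchange h).act (s w) (x w)) huv
    (m := encodeMessage (s u).1) (by simp [exchange, hu])
    (fun w h1 h2 => by simp [exchange, (hw w h1 h2).not_gt])
  have h2 : perceive G (fun w => (exchange h).act (s w) (x w)) v =
      some (some (encodeMessage (s u).1)) := by
    unfold perceive
    rw [h1, NoCD_hear_singleton]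
    simp [exchange, hv.not_gt]
  change (s u).1 ∈ receive (perceive G (fun w => (exchange h).act (s w) (x w)) v) (s v).2
  rw [h2]
  simp [receive, decodeMessage_encodeMessage]

/-- After a block of exchange slots, the states are unchanged and the buffers hold, besides their
initial contents, only states of neighbours. -/
theorem surely_exchange (h M : ℕ) (s : V → κ × Finset κ) :
    Surely (List.replicate M (globalSlot G (exchange (b := b) h)))
      (fun s' => (∀ v, (s' v).1 = (s v).1) ∧
        ∀ v, ∀ k ∈ (s' v).2, k ∈ (s v).2 ∨ ∃ u, G.Adj v u ∧ k = (s u).1) s := by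
  refine surely_of_invariant ⟨fun _ => rfl, fun _ _ hk => Or.inl hk⟩ ?_
  rintro i hi s' x ⟨h1, h2⟩
  rw [List.eq_of_mem_replicate hi]
  refine ⟨h1, fun v k hk => ?_⟩
  rcases mem_globalSlot_exchange G hk with hk | ⟨u, hu, rfl⟩
  · exact h2 v k hk
  · exact Or.inr ⟨u, hu, h1 u⟩

end Rounds

/-! ## Success probabilities of the exchange -/

section Exchange

variable {V : Type*} [Fintype V]

open Classical in
/-- The neighbours of a vertex. -/
noncomputable def nbrs (G : SimpleGraph V) (v : V) : Finset V :=
  Finset.univ.filter fun w => G.Adj v w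

@[simp] theorem mem_nbrs {G : SimpleGraph V} {v w : V} : w ∈ nbrs G v ↔ G.Adj v w := by
  simp [nbrs]

variable [DecidableEq V]

/-- Resampling one coordinate does not change an expectation. -/
theorem expect_update {Ω : Type*} [Fintype Ω] [Nonempty Ω] (f : (V → Ω) → ℝ) (v : V) :
    𝔼 x, f x = 𝔼 x, 𝔼 a, f (Function.update x v a) := by
  have h1 : 𝔼 x, 𝔼 a, f (Function.update x v a) =
      𝔼 q : (V → Ω) × Ω, f (Function.update q.1 v q.2) :=
    (Finset.expect_product' Finset.univ Finset.univ fun x a => f (Function.update x v a)).symm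
  have h2 : 𝔼 q : (V → Ω) × Ω, f q.1 = 𝔼 x, 𝔼 _a : Ω, f x :=
    Finset.expect_product' Finset.univ Finset.univ fun x _ => f x
  -- Swapping coordinate `v` with the fresh sample permutes the pairs, so the updated vector is
  -- distributed like the original one.
  have hi : Function.Involutive
      fun q : (V → Ω) × Ω => (Function.update q.1 v q.2, q.1 v) := by
    rintro ⟨x, a⟩
    simp
  rw [h1, Fintype.expect_equiv hi.toPerm (fun q => f (Function.update q.1 v q.2)) (fun q => f q.1)
    (fun q => rfl), h2]
  simp

variable {b h : ℕ}

theorem expect_lt (hN : h ≤ 2 ^ b) :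
    𝔼 a : Fin (2 ^ b), (if a.val < h then (1 : ℝ) else 0) = h / 2 ^ b := by
  rw [Fintype.expect_eq_sum_div_card, Finset.sum_boole, Fintype.card_fin]
  have : (Finset.univ.filter fun a : Fin (2 ^ b) => a.val < h).card = h := by
    rw [← Finset.card_range h]
    refine Finset.card_bij (fun a _ => a.val) (by simp) (fun a _ c _ hac => Fin.ext hac) ?_
    intro c hc
    have hc' : c < h := by simpa using hc
    exact ⟨⟨c, hc'.trans_le hN⟩, by simpa using hc', rfl⟩
  rw [this]
  push_cast
  rfl

theorem expect_apply_lt (hN : h ≤ 2 ^ b) (u : V) :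
    𝔼 x : V → Fin (2 ^ b), (if (x u).val < h then (1 : ℝ) else 0) = h / 2 ^ b := by
  rw [expect_update _ u]
  simp [expect_lt hN]

theorem expect_apply_lt_mul (hN : h ≤ 2 ^ b) {u w : V} (hw : w ≠ u) :
    𝔼 x : V → Fin (2 ^ b), ((if (x u).val < h then (1 : ℝ) else 0) *
      (if (x w).val < h then (1 : ℝ) else 0)) = (h / 2 ^ b) * (h / 2 ^ b) := by
  rw [expect_update _ u]
  simp only [Function.update_self, Function.update_of_ne hw]
  simp only [← Finset.expect_mul, expect_lt hN, ← Finset.mul_expect, expect_apply_lt hN]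

variable {κ : Type*} [Encodable κ] (G : SimpleGraph V)

/-- Every device sends with probability `1 / D`. Delivery fails only if `u` is silent or some member
of `W` sends together with `u`. This has probability at most `1 - 1 / D` plus `|W| ≤ Δ ≤ D / 2`
terms `1 / D ^ 2`. -/
theorem expect_not_mem_exchange_le {Δ D : ℕ} (hD : 2 ^ b = h * D) (hDΔ : 2 * Δ ≤ D)
    (hG : ∀ v, (nbrs G v).card ≤ Δ) {u v : V} (huv : G.Adj v u) (s : V → κ × Finset κ) :
    𝔼 x : V → Fin (2 ^ b), ind (fun x => (s u).1 ∉ (globalSlot G (exchange h) s x v).2) x ≤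
      1 - 1 / (2 * D : ℝ) := by
  have hpos : 0 < h * D := hD ▸ Nat.two_pow_pos b
  have hD0 : 0 < D := Nat.pos_of_mul_pos_left hpos
  have hh0 : 0 < h := Nat.pos_of_mul_pos_right hpos
  have hN : h ≤ 2 ^ b := hD ▸ Nat.le_mul_of_pos_right h hD0
  have hfrac : (h : ℝ) / 2 ^ b = 1 / D := by
    have : (2 : ℝ) ^ b = h * D := by exact_mod_cast hD
    rw [this]
    have : (h : ℝ) ≠ 0 := by positivity
    field_simp
  -- `v` belongs to `W` because it has to listen; since `u` is removed, `W` still has at most `Δ`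
  -- elements.
  set W := insert v ((nbrs G v).erase u) with hW
  have hWu : ∀ w ∈ W, w ≠ u := by
    intro w hw
    rcases Finset.mem_insert.mp hw with rfl | hw
    · exact huv.ne
    · exact Finset.ne_of_mem_erase hw
  have hWcard : W.card ≤ Δ := by
    refine (Finset.card_insert_le _ _).trans ?_
    rw [Finset.card_erase_add_one (mem_nbrs.mpr huv)]
    exact hG v
  set one : (V → Fin (2 ^ b)) → V → ℝ := fun x w => if (x w).val < h then (1 : ℝ) else 0 with hone
  have hone0 : ∀ x w, 0 ≤ one x w := by
    intro x w; simp only [hone]; split_ifs <;> norm_num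
  have key : ∀ x, ind (fun x => (s u).1 ∉ (globalSlot G (exchange h) s x v).2) x ≤
      1 - one x u + ∑ w ∈ W, one x u * one x w := by
    intro x
    have hs0 : 0 ≤ ∑ w ∈ W, one x u * one x w :=
      Finset.sum_nonneg fun w _ => mul_nonneg (hone0 _ _) (hone0 _ _)
    by_cases hu : (x u).val < h
    · have hu1 : one x u = 1 := if_pos hu
      by_cases hw : ∃ w ∈ W, (x w).val < h
      · obtain ⟨w, hw, hxw⟩ := hw
        have h1 : one x w = 1 := if_pos hxw
        have h2 : one x u * one x w ≤ ∑ w ∈ W, one x u * one x w :=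
          Finset.single_le_sum (f := fun w => one x u * one x w)
            (fun w _ => mul_nonneg (hone0 _ _) (hone0 _ _)) hw
        have h3 := ind_le_one (fun x => (s u).1 ∉ (globalSlot G (exchange h) s x v).2) x
        rw [h1, hu1] at h2
        rw [hu1] at hs0 ⊢
        linarith
      · push Not at hw
        rw [ind_of_not]
        · rw [hu1] at hs0 ⊢
          linarith
        · rw [not_not]
          refine mem_globalSlot_exchange_of_only G huv hu (hw v (by simp [hW])) ?_
          intro w hvw hwu
          exact hw w (by simp [hW, hvw, hwu])
    · have hu1 : one x u = 0 := if_neg hu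
      have h3 := ind_le_one (fun x => (s u).1 ∉ (globalSlot G (exchange h) s x v).2) x
      rw [hu1] at hs0 ⊢
      linarith
  refine (Finset.expect_le_expect fun x _ => key x).trans ?_
  rw [Finset.expect_add_distrib, Finset.expect_sub_distrib, Finset.expect_sum_comm,
    Finset.sum_congr rfl fun w hw => expect_apply_lt_mul hN (hWu w hw), expect_apply_lt hN, hfrac,
    Fintype.expect_const, Finset.sum_const, nsmul_eq_mul]
  have hD1 : (0 : ℝ) < D := by exact_mod_cast hD0
  have h4 : (W.card : ℝ) * (1 / D * (1 / D)) ≤ (D / 2) * (1 / D * (1 / D)) := by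
    refine mul_le_mul_of_nonneg_right ?_ (by positivity)
    have h5 : ((2 * W.card : ℕ) : ℝ) ≤ D := by
      exact_mod_cast (Nat.mul_le_mul_left 2 hWcard).trans hDΔ
    push_cast at h5
    linarith
  have h6 : (D / 2 : ℝ) * (1 / D * (1 / D)) = 1 / D - 1 / (2 * D) := by
    field_simp; norm_num
  linarith

/-- During an exchange states do not change and buffers only grow, so the failure bounds of the
single slots multiply. -/
theorem wp_exchange_le {Δ D : ℕ} (hD : 2 ^ b = h * D) (hDΔ : 2 * Δ ≤ D)
    (hG : ∀ v, (nbrs G v).card ≤ Δ) {u v : V} (huv : G.Adj v u)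
    (M : ℕ) (k : κ) (s : V → κ × Finset κ) (hk : (s u).1 = k) :
    wp (List.replicate M (globalSlot G (exchange (b := b) h)))
      (ind fun s' => k ∉ (s' v).2) s ≤ (1 - 1 / (2 * D : ℝ)) ^ M := by
  have hpos : 0 < h * D := hD ▸ Nat.two_pow_pos b
  have hD0 : 1 ≤ D := Nat.pos_of_mul_pos_left hpos
  have hδ : 0 ≤ 1 - 1 / (2 * D : ℝ) := by
    have : (1 : ℝ) ≤ D := by exact_mod_cast hD0
    have : 1 / (2 * D : ℝ) ≤ 1 := by
      rw [div_le_one (by positivity)]; linarith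
    linarith
  induction M generalizing s with
  | zero => simpa using ind_le_one _ _
  | succ M ih =>
    rw [List.replicate_succ, wp_cons, pow_succ']
    have h1 : ∀ x : V → Fin (2 ^ b), wp (List.replicate M (globalSlot G (exchange (b := b) h)))
        (ind fun s' => k ∉ (s' v).2) (globalSlot G (exchange h) s x) ≤
        ind (fun x => (s u).1 ∉ (globalSlot G (exchange h) s x v).2) x *
          (1 - 1 / (2 * D : ℝ)) ^ M := by
      intro x
      by_cases hx : (s u).1 ∈ (globalSlot G (exchange h) s x v).2
      · rw [ind_of_not (by simpa using hx), zero_mul]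
        refine wp_le_const (Q := fun s' => k ∈ (s' v).2) (surely_of_invariant (hk ▸ hx) ?_) ?_
        · intro i hi s' x' hs'
          rw [List.eq_of_mem_replicate hi]
          exact subset_globalSlot_exchange G h s' x' v hs'
        · intro s' hs'
          exact (ind_of_not (by simpa using hs')).le
      · rw [ind_of (by simpa using hx), one_mul]
        exact ih _ hk
    refine (Finset.expect_le_expect fun x _ => h1 x).trans ?_
    rw [← Finset.expect_mul]
    exact mul_le_mul_of_nonneg_right (expect_not_mem_exchange_le G hD hDΔ hG huv s)
      (pow_nonneg hδ M)

/-- A block of `2 * D` slots contributes `(1 - 1 / (2 * D)) ^ (2 * D) ≤ e⁻¹ < 1 / 2`. -/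
theorem one_sub_pow_le_half {D : ℕ} (hD : 1 ≤ D) (m : ℕ) :
    (1 - 1 / (2 * D : ℝ)) ^ (2 * D * m) ≤ (1 / 2) ^ m := by
  have hD1 : (1 : ℝ) ≤ D := by exact_mod_cast hD
  have h1 : (1 - 1 / (2 * D : ℝ)) ^ (2 * D) ≤ 1 / 2 := by
    have h2 := Real.one_sub_div_pow_le_exp_neg (n := 2 * D) (t := 1) (by push_cast; linarith)
    push_cast at h2
    exact h2.trans Real.exp_neg_one_lt_half.le
  have hδ : 0 ≤ 1 - 1 / (2 * D : ℝ) := by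
    have : 1 / (2 * D : ℝ) ≤ 1 := by
      rw [div_le_one (by positivity)]; linarith
    linarith
  rw [pow_mul]
  exact pow_le_pow_left₀ (pow_nonneg hδ _) h1 m

theorem wp_exchange_le_half {Δ D : ℕ} (hD : 2 ^ b = h * D) (hDΔ : 2 * Δ ≤ D)
    (hG : ∀ v, (nbrs G v).card ≤ Δ) {u v : V} (huv : G.Adj v u)
    (m : ℕ) (k : κ) (s : V → κ × Finset κ) (hk : (s u).1 = k) :
    wp (List.replicate (2 * D * m) (globalSlot G (exchange (b := b) h)))
      (ind fun s' => k ∉ (s' v).2) s ≤ (1 / 2) ^ m :=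
  (wp_exchange_le G hD hDΔ hG huv _ k s hk).trans <|
    one_sub_pow_le_half (Nat.pos_of_mul_pos_left (hD ▸ Nat.two_pow_pos b : 0 < h * D)) m

end Exchange

/-! ## The coloring program -/

/-- The state of a device in the coloring protocol. -/
structure DevState where
  /-- The random identifier. -/
  id : ℕ
  /-- The current candidate for the color, which is final if `done`. -/
  col : ℕ
  done : Bool
  /-- The identifiers of the neighbours. -/
  nb : Finset ℕ
  /-- The pairs of an identifier and a color received from neighbours. -/
  heard : Finset (ℕ × ℕ)

namespace DevState

/-- A device state is a tuple. -/
def equivTuple : DevState ≃ ℕ × ℕ × Bool × Finset ℕ × Finset (ℕ × ℕ) where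
  toFun k := (k.id, k.col, k.done, k.nb, k.heard)
  invFun t := ⟨t.1, t.2.1, t.2.2.1, t.2.2.2.1, t.2.2.2.2⟩
  left_inv _ := rfl
  right_inv _ := rfl

instance : Encodable DevState := Encodable.ofEquiv _ equivTuple

/-- The test by which a device with state `k` and received states `B` makes its color final:
every neighbour reports, has heard all of its neighbours, and knows of no conflict. -/
def Check (k : DevState) (B : Finset DevState) : Prop :=
  ∀ i ∈ k.nb, ∃ w ∈ B, w.id = i ∧ w.col ≠ k.col ∧ (∀ j ∈ w.nb, ∃ c, (j, c) ∈ w.heard) ∧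
    ∀ p ∈ w.heard, p.2 = k.col → p.1 = k.id

variable {b : ℕ}

/-- Choose a random identifier. -/
def chooseId (k : DevState) (_ : Finset DevState) (x : Fin (2 ^ b)) : DevState :=
  { k with id := x.val }

/-- Store the identifiers of the neighbours. -/
def learn (k : DevState) (B : Finset DevState) (_ : Fin (2 ^ b)) : DevState :=
  { k with nb := B.image DevState.id }

/-- Choose a candidate color among `q`, unless the color is final. -/
def chooseColor (q : ℕ) (k : DevState) (_ : Finset DevState) (x : Fin (2 ^ b)) : DevState :=
  { k with col := if k.done then k.col else x.val % q }

/-- Store the candidate colors of the neighbours. -/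
def collect (k : DevState) (B : Finset DevState) (_ : Fin (2 ^ b)) : DevState :=
  { k with heard := B.image fun w => (w.id, w.col) }

open Classical in
/-- Make the color final if the test is passed. -/
noncomputable def finalize (k : DevState) (B : Finset DevState) (_ : Fin (2 ^ b)) : DevState :=
  { k with done := k.done || decide (Check k B) }

/-- Keep the state. -/
def keep (k : DevState) (_ : Finset DevState) (_ : Fin (2 ^ b)) : DevState := k

end DevState

section Coloring

open DevState

/-- One phase of the coloring program, with `M` slots for each exchange. -/
noncomputable def phase (b h q M : ℕ) : List (ProgramSlot (DevState × Finset DevState) b) :=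
  think (chooseColor q) :: (List.replicate M (exchange h) ++
    think collect :: (List.replicate M (exchange h) ++ [think finalize]))

/-- The coloring program: `M'` slots in which the devices learn the identifiers of their
neighbours, `K` phases, and `M'` slots in which they learn the colors of their neighbours. -/
noncomputable def coloringProgram (b h q M M' K : ℕ) :
    List (ProgramSlot (DevState × Finset DevState) b) :=
  think chooseId :: (List.replicate M' (exchange h) ++
    think learn :: ((List.replicate K (phase b h q M)).flatten ++
      think keep :: List.replicate M' (exchange h)))

theorem length_coloringProgram (b h q M M' K : ℕ) :
    (coloringProgram b h q M M' K).length = 3 + 2 * M' + K * (3 + 2 * M) := by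
  simp only [coloringProgram, phase, List.length_cons, List.length_append, List.length_replicate,
    List.length_flatten, List.map_replicate, List.sum_replicate, List.length_nil, smul_eq_mul]
  ring

/-! ### Soundness and completeness of the test for final colors -/

section

variable {V : Type*} {G : SimpleGraph V} {q : ℕ}

/-- The identifiers are distinct, and every device knows those of its neighbours. -/
structure KnowsIds (G : SimpleGraph V) (k : V → DevState) : Prop where
  injective : Function.Injective fun v => (k v).id
  mem_nb : ∀ v j, j ∈ (k v).nb ↔ ∃ w, G.Adj v w ∧ (k w).id = j

/-- The invariant of the phases. -/
structure PhaseInv (G : SimpleGraph V) (q : ℕ) (k : V → DevState) : Prop where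
  knowsIds : KnowsIds G k
  col_lt : ∀ v, (k v).col < q
  proper : ∀ u v, (plusSquare G).Adj u v → (k u).done = true → (k v).done = true →
    (k u).col ≠ (k v).col

/-- The stored pairs are pairs of neighbours, and the buffers hold states of neighbours. -/
structure Received (G : SimpleGraph V) (k : V → DevState) (B : V → Finset DevState) : Prop where
  heard : ∀ v, ∀ p ∈ (k v).heard, ∃ u, G.Adj v u ∧ p = ((k u).id, (k u).col)
  buffer : ∀ v, ∀ k' ∈ B v, ∃ u, G.Adj v u ∧ k' = k u

/-- Soundness. A neighbour of `v` has reported its own color. At distance two, the middle vertex `w`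
has reported the color of `u`, and a pair with the color of `v` must carry the identifier of `v`;
identifiers being distinct, `u` would be `v`. -/
theorem col_ne_of_check {k : V → DevState} {B : V → Finset DevState} (hk : KnowsIds G k)
    (hB : Received G k B) {u v : V} (huv : (plusSquare G).Adj u v) (hv : Check (k v) (B v)) :
    (k u).col ≠ (k v).col := by
  obtain ⟨hne, hadj | ⟨w, huw, hwv⟩⟩ := huv
  · obtain ⟨w', hw', hid, hcol, -⟩ := hv (k u).id ((hk.mem_nb v _).mpr ⟨u, hadj.symm, rfl⟩)
    obtain ⟨u', -, rfl⟩ := hB.buffer v w' hw'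
    rwa [hk.injective hid] at hcol
  · obtain ⟨w', hw', hid, -, hall, hconf⟩ :=
      hv (k w).id ((hk.mem_nb v _).mpr ⟨w, hwv.symm, rfl⟩)
    obtain ⟨w'', -, rfl⟩ := hB.buffer v w' hw'
    rw [hk.injective hid] at hall hconf
    obtain ⟨c, hc⟩ := hall (k u).id ((hk.mem_nb w _).mpr ⟨u, huw.symm, rfl⟩)
    obtain ⟨u', -, hu'⟩ := hB.heard w _ hc
    rw [Prod.mk.injEq] at hu'
    have hu'' : u = u' := hk.injective hu'.1
    subst hu''
    intro hcol
    exact hne (hk.injective (hconf _ hc (hu'.2.trans hcol)))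

/-- Completeness: if no message relevant to `v` is lost and there is no conflict, the test passes.
-/
theorem check_of_received {k : V → DevState} {B : V → Finset DevState} (hk : KnowsIds G k)
    (hB : Received G k B) {v : V} (h1 : ∀ w, G.Adj v w → k w ∈ B v)
    (h2 : ∀ w, G.Adj v w → ∀ u, G.Adj w u → ((k u).id, (k u).col) ∈ (k w).heard)
    (h3 : ∀ u, (plusSquare G).Adj v u → (k u).col ≠ (k v).col) : Check (k v) (B v) := by
  intro i hi
  obtain ⟨w, hvw, rfl⟩ := (hk.mem_nb v i).mp hi
  refine ⟨k w, h1 w hvw, rfl, h3 w ⟨hvw.ne, Or.inl hvw⟩, ?_, ?_⟩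
  · intro j hj
    obtain ⟨u, hwu, rfl⟩ := (hk.mem_nb w j).mp hj
    exact ⟨_, h2 w hvw u hwu⟩
  · intro p hp hpc
    obtain ⟨u, hwu, rfl⟩ := hB.heard w p hp
    by_cases huv : u = v
    · rw [huv]
    · exact absurd hpc (h3 u ⟨Ne.symm huv, Or.inr ⟨w, hvw, hwu⟩⟩)

variable {b : ℕ}

theorem PhaseInv.chooseColor {k : V → DevState} (hk : PhaseInv G q k) (hq : 0 < q)
    (x : V → Fin (2 ^ b)) (B : V → Finset DevState) :
    PhaseInv G q fun v => DevState.chooseColor q (k v) (B v) (x v) := by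
  refine ⟨⟨hk.knowsIds.injective, hk.knowsIds.mem_nb⟩, fun v => ?_, fun u v huv hu hv => ?_⟩
  · simp only [DevState.chooseColor]
    split_ifs
    · exact hk.col_lt v
    · exact Nat.mod_lt _ hq
  · have hu' : (k u).done = true := hu
    have hv' : (k v).done = true := hv
    simpa [DevState.chooseColor, hu', hv'] using hk.proper u v huv hu hv

theorem PhaseInv.collect {k : V → DevState} (hk : PhaseInv G q k)
    (x : V → Fin (2 ^ b)) (B : V → Finset DevState) :
    PhaseInv G q fun v => DevState.collect (k v) (B v) (x v) :=
  ⟨⟨hk.knowsIds.injective, hk.knowsIds.mem_nb⟩, hk.col_lt, hk.proper⟩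

/-- Devices that become final simultaneously do no harm: a test passed by either endpoint already
separates the two colors. -/
theorem PhaseInv.finalize {k : V → DevState} {B : V → Finset DevState} (hk : PhaseInv G q k)
    (hB : Received G k B) (x : V → Fin (2 ^ b)) :
    PhaseInv G q fun v => DevState.finalize (k v) (B v) (x v) := by
  refine ⟨⟨hk.knowsIds.injective, hk.knowsIds.mem_nb⟩, hk.col_lt, fun u v huv hu hv => ?_⟩
  simp only [DevState.finalize, Bool.or_eq_true, decide_eq_true_eq] at hu hv ⊢
  rcases hv with hv | hv
  · rcases hu with hu | hu
    · exact hk.proper u v huv hu hv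
    · exact (col_ne_of_check hk.knowsIds hB huv.symm hu).symm
  · exact col_ne_of_check hk.knowsIds hB huv hv

end

/-! ### Sure invariants of a phase and the failure probability of its exchanges -/

section

variable {V : Type*} [Fintype V] (G : SimpleGraph V) {b h q M M' K : ℕ}

/-- The joint transitions of all devices in the slots of a program. -/
noncomputable def globalProgram {σ : Type*} (p : List (ProgramSlot σ b)) :
    List ((V → σ) → (V → Fin (2 ^ b)) → (V → σ)) := p.map (globalSlot G)

/-- The states without the buffers. -/
def states {κ : Type*} (s : V → κ × Finset κ) (v : V) : κ := (s v).1

/-- The buffers. -/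
def buffers {κ : Type*} (s : V → κ × Finset κ) (v : V) : Finset κ := (s v).2

theorem surely_exchange_of_empty {κ : Type*} [Encodable κ] {s : V → κ × Finset κ}
    (hs : ∀ v, (s v).2 = ∅) :
    Surely (globalProgram G (List.replicate M (exchange (b := b) h)))
      (fun s' => states s' = states s ∧ ∀ v, ∀ k ∈ (s' v).2, ∃ u, G.Adj v u ∧ k = states s u)
      s := by
  unfold globalProgram
  rw [List.map_replicate]
  refine (surely_exchange G h M s).mono fun s' hs' => ⟨funext hs'.1, fun v k hk => ?_⟩
  rcases hs'.2 v k hk with h1 | h1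
  · simp [hs v] at h1
  · exact h1

variable {G}

/-- The part of a phase after the choice of the candidates. -/
noncomputable def phaseTail (b h M : ℕ) : List (ProgramSlot (DevState × Finset DevState) b) :=
  List.replicate M (exchange h) ++
    think collect :: (List.replicate M (exchange h) ++ [think finalize])

/-- Identifiers and candidates do not change between the two exchanges, so the stored pairs still
describe the current states when the test is made. -/
theorem received_collect {s s' s'' : V → DevState × Finset DevState}
    {x : V → Fin (2 ^ b)} (h1 : states s' = states s)
    (h2 : ∀ v, ∀ k ∈ (s' v).2, ∃ u, G.Adj v u ∧ k = states s u)
    (h3 : states s'' = states (globalSlot G (think collect) s' x))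
    (h4 : ∀ v, ∀ k ∈ (s'' v).2, ∃ u, G.Adj v u ∧
      k = states (globalSlot G (think collect) s' x) u) :
    Received G (states s'') (buffers s'') := by
  refine ⟨fun v p hp => ?_, fun v k hk => ?_⟩
  · rw [h3] at hp ⊢
    simp only [states, globalSlot_think, DevState.collect, Finset.mem_image] at hp ⊢
    obtain ⟨k, hk, rfl⟩ := hp
    obtain ⟨u, hu, rfl⟩ := h2 v k hk
    refine ⟨u, hu, ?_⟩
    rw [← h1]
    rfl
  · rw [h3]
    exact h4 v k hk

theorem surely_phaseTail {s : V → DevState × Finset DevState} (hs : PhaseInv G q (states s))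
    (hs0 : ∀ v, (s v).2 = ∅) :
    Surely (globalProgram G (phaseTail b h M))
      (fun s' => PhaseInv G q (states s') ∧
        ∀ v, (states s v).done = true → (states s' v).done = true) s := by
  unfold phaseTail globalProgram
  rw [List.map_append, surely_append]
  refine (surely_exchange_of_empty G hs0).mono ?_
  rintro s' ⟨h1, h2⟩
  rw [List.map_cons, surely_cons]
  intro x
  rw [List.map_append, surely_append]
  refine (surely_exchange_of_empty G (s := globalSlot G (think collect) s' x) fun _ => rfl).mono ?_
  rintro s'' ⟨h3, h4⟩ y
  have hB := received_collect h1 h2 h3 h4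
  have hk : PhaseInv G q (states s'') := by
    rw [h3]
    exact PhaseInv.collect (k := states s') (h1 ▸ hs) x (buffers s')
  refine ⟨hk.finalize hB y, fun v hv => ?_⟩
  have h5 : (states s'' v).done = true := by
    rw [h3]
    change (states s' v).done = true
    rwa [h1]
  simp only [states] at h5
  simp [states, globalSlot_think, DevState.finalize, h5]

theorem surely_phase {s : V → DevState × Finset DevState} (hs : PhaseInv G q (states s))
    (hq : 0 < q) :
    Surely (globalProgram G (phase b h q M))
      (fun s' => PhaseInv G q (states s') ∧
        ∀ v, (states s v).done = true → (states s' v).done = true) s := by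
  intro x
  exact surely_phaseTail (s := globalSlot G (think (chooseColor q)) s x)
    (hs.chooseColor hq x (buffers s)) fun _ => rfl

/-- A union bound for sequential composition: `Q` is certain after `p`, and `R` fails with
probability at most `a`. -/
theorem wp_append_le {S X : Type*} [Fintype X] [Nonempty X] {p p' : List (S → X → S)} {f : S → ℝ}
    {Q R : S → Prop} {s : S} {a ε : ℝ} (hf : ∀ s, f s ≤ 1) (hQ : Surely p Q s)
    (hR : wp p (ind fun s => ¬ R s) s ≤ a) (hε : 0 ≤ ε)
    (h : ∀ s, Q s → R s → wp p' f s ≤ ε) : wp (p ++ p') f s ≤ a + ε := by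
  rw [wp_append]
  have h1 : wp p (wp p' f) s ≤ wp p (fun s => ind (fun s => ¬ R s) s + ε) s := by
    refine wp_le_wp hQ fun s hs => ?_
    by_cases hr : R s
    · rw [ind_of_not (by simpa using hr), zero_add]
      exact h s hs hr
    · rw [ind_of (by simpa using hr)]
      have := wp_le_const (p := p') (Q := fun _ => True) (s := s)
        (surely_of_invariant trivial fun _ _ _ _ _ => trivial) fun s _ => hf s
      linarith
  refine h1.trans ?_
  rw [wp_add, wp_const]
  linarith

variable [DecidableEq V]

variable (G) in
theorem wp_exchange_exists_le {κ : Type*} [Encodable κ] {Δ D : ℕ} (hD : 2 ^ b = h * D)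
    (hDΔ : 2 * Δ ≤ D) (hG : ∀ v, (nbrs G v).card ≤ Δ) (T : Finset (V × V))
    (hT : ∀ p ∈ T, G.Adj p.1 p.2) (m : ℕ) (s : V → κ × Finset κ) :
    wp (globalProgram G (List.replicate (2 * D * m) (exchange (b := b) h)))
      (ind fun s' => ∃ p ∈ T, states s p.2 ∉ (s' p.1).2) s ≤ T.card * (1 / 2) ^ m := by
  unfold globalProgram
  rw [List.map_replicate]
  exact wp_ind_exists_le _ _ _ _ fun p hp => wp_exchange_le_half G hD hDΔ hG (hT p hp) m _ s rfl

/-- For the test at `v`, the neighbours of `v` must hear all their neighbours in the first exchange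
(`T₁`, at most `Δ ^ 2` deliveries), and `v` must hear all its neighbours in the second (`T₂`, at
most `Δ`). -/
theorem wp_phaseTail_le {Δ D m : ℕ} (hD : 2 ^ b = h * D) (hDΔ : 2 * Δ ≤ D)
    (hG : ∀ v, (nbrs G v).card ≤ Δ) {s : V → DevState × Finset DevState}
    (hs : PhaseInv G q (states s)) (hs0 : ∀ v, (s v).2 = ∅) (v : V)
    (hv : ∀ u, (plusSquare G).Adj v u → (states s u).col ≠ (states s v).col) :
    wp (globalProgram G (phaseTail b h (2 * D * m)))
      (ind fun s' => ¬ (states s' v).done = true) s ≤ (Δ ^ 2 + Δ) * (1 / 2) ^ m := by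
  set T₁ : Finset (V × V) := (nbrs G v).biUnion fun w => (nbrs G w).image fun u => (w, u) with hT₁
  set T₂ : Finset (V × V) := (nbrs G v).image fun w => (v, w) with hT₂
  have hc₁ : (T₁.card : ℝ) ≤ Δ ^ 2 := by
    have : T₁.card ≤ Δ * Δ :=
      (Finset.card_biUnion_le_card_mul _ _ Δ fun w _ => Finset.card_image_le.trans (hG w)).trans
        (Nat.mul_le_mul_right _ (hG v))
    rw [sq]
    exact_mod_cast this
  have hc₂ : (T₂.card : ℝ) ≤ Δ := by exact_mod_cast Finset.card_image_le.trans (hG v)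
  have hp : (0 : ℝ) ≤ (1 / 2) ^ m := by positivity
  unfold phaseTail globalProgram
  rw [List.map_append, add_mul]
  refine wp_append_le (ind_le_one _) (surely_exchange_of_empty G hs0)
    (R := fun s' => ∀ w, G.Adj v w → ∀ u, G.Adj w u → states s u ∈ (s' w).2) ?_
    (by positivity) ?_
  · refine le_trans (le_of_eq ?_) ((wp_exchange_exists_le G hD hDΔ hG T₁ ?_ m s).trans
      (mul_le_mul_of_nonneg_right hc₁ hp))
    · congr 2
      ext s'
      simp only [hT₁, Finset.mem_biUnion, Finset.mem_image, mem_nbrs]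
      push Not
      constructor
      · rintro ⟨w, hw, u, hu, hn⟩
        exact ⟨(w, u), ⟨w, hw, u, hu, rfl⟩, hn⟩
      · rintro ⟨_, ⟨w, hw, u, hu, rfl⟩, hn⟩
        exact ⟨w, hw, u, hu, hn⟩
    · simp only [hT₁, Finset.mem_biUnion, Finset.mem_image, mem_nbrs]
      rintro _ ⟨w, hw, u, hu, rfl⟩
      exact hu
  · rintro s' ⟨h1, h2⟩ hR
    rw [List.map_cons, wp_cons]
    refine (Finset.expect_le_expect (g := fun _ => (Δ : ℝ) * (1 / 2) ^ m) fun x _ => ?_).trans_eq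
      (Fintype.expect_const _)
    -- After complete delivery the last slot makes the color final surely, whence the error term
    -- `0`.
    rw [List.map_append, ← add_zero ((Δ : ℝ) * _)]
    refine wp_append_le (ind_le_one _)
      (surely_exchange_of_empty G (s := globalSlot G (think collect) s' x) fun _ => rfl)
      (R := fun s'' => ∀ w, G.Adj v w →
        states (globalSlot G (think collect) s' x) w ∈ (s'' v).2) ?_ le_rfl ?_
    · refine le_trans (le_of_eq ?_) ((wp_exchange_exists_le G hD hDΔ hG T₂ ?_ m
        (globalSlot G (think collect) s' x)).trans
        (mul_le_mul_of_nonneg_right hc₂ hp))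
      · congr 2
        ext s'
        simp [hT₂]
      · simp [hT₂]
    · rintro s'' ⟨h3, h4⟩ hR'
      have hB := received_collect h1 h2 h3 h4
      have hk : PhaseInv G q (states s'') := by
        rw [h3]
        exact PhaseInv.collect (k := states s') (h1 ▸ hs) x (buffers s')
      have hcol : ∀ u, (states s'' u).id = (states s u).id ∧
          (states s'' u).col = (states s u).col := by
        intro u
        rw [h3, ← h1]
        exact ⟨rfl, rfl⟩
      have hcheck : Check (states s'' v) (buffers s'' v) := by
        refine check_of_received hk.knowsIds hB ?_ ?_ ?_
        · intro w hw
          rw [h3]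
          exact hR' w hw
        · intro w hw u hu
          rw [(hcol u).1, (hcol u).2, h3]
          exact Finset.mem_image_of_mem (fun w => (w.id, w.col)) (hR w hw u hu)
        · intro u hu
          rw [(hcol u).2, (hcol v).2]
          exact hv u hu
      refine (wp_le_const (Q := fun s => (states s v).done = true) ?_ fun s hs => ?_)
      · intro y
        simp only [states, buffers] at hcheck
        simp [states, globalSlot_think, DevState.finalize, hcheck]
      · exact (ind_of_not (by simpa using hs)).le

end

/-! ### Color conflicts, iterated phases and the whole coloring program -/

section

variable {V : Type*} [Fintype V] {G : SimpleGraph V} {b h q M M' K : ℕ}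

theorem surely_phases {s : V → DevState × Finset DevState} (hs : PhaseInv G q (states s))
    (hq : 0 < q) :
    Surely (globalProgram G (List.replicate K (phase b h q M)).flatten)
      (fun s' => PhaseInv G q (states s')) s := by
  unfold globalProgram
  rw [List.map_flatten, List.map_replicate]
  exact surely_flatten_replicate (Q := fun s' => PhaseInv G q (states s')) hs
    (fun s hs => (surely_phase hs hq).mono fun s' hs' => hs'.1) K

variable [DecidableEq V]

/-- In the neighbourhood of each neighbour `w`, the vertex `v` is replaced by `w` itself, so `w`
accounts for at most `Δ` vertices. Having `Δ ^ 2` rather than `Δ ^ 2 + Δ` keeps the conflict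
probability near `1 / 2`. -/
theorem card_nbrs_plusSquare_le {Δ : ℕ} (hG : ∀ v, (nbrs G v).card ≤ Δ) (v : V) :
    (nbrs (plusSquare G) v).card ≤ Δ ^ 2 := by
  have h1 : nbrs (plusSquare G) v ⊆ (nbrs G v).biUnion fun w => insert w ((nbrs G w).erase v) := by
    intro u hu
    obtain ⟨hne, hadj | ⟨w, hw, hwu⟩⟩ := mem_nbrs.mp hu
    · exact Finset.mem_biUnion.mpr ⟨u, mem_nbrs.mpr hadj, Finset.mem_insert_self _ _⟩
    · refine Finset.mem_biUnion.mpr ⟨w, mem_nbrs.mpr hw, Finset.mem_insert_of_mem ?_⟩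
      exact Finset.mem_erase.mpr ⟨hne.symm, mem_nbrs.mpr hwu⟩
  refine (Finset.card_le_card h1).trans ((Finset.card_biUnion_le_card_mul _ _ Δ ?_).trans ?_)
  · intro w hw
    refine (Finset.card_insert_le _ _).trans ?_
    rw [Finset.card_erase_add_one (mem_nbrs.mpr (mem_nbrs.mp hw).symm)]
    exact hG w
  · rw [sq]
    exact Nat.mul_le_mul_right _ (hG v)

/-- Reduction modulo `q` need not be uniform, but a residue has at most one preimage per quotient,
hence at most `2 ^ b / q + 1`. -/
theorem expect_mod_eq_le (hq : 0 < q) (c : ℕ) :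
    𝔼 a : Fin (2 ^ b), (if a.val % q = c then (1 : ℝ) else 0) ≤ 1 / q + 1 / 2 ^ b := by
  rw [Fintype.expect_eq_sum_div_card, Finset.sum_boole, Fintype.card_fin]
  have h1 : (Finset.univ.filter fun a : Fin (2 ^ b) => a.val % q = c).card ≤ 2 ^ b / q + 1 := by
    have h2 : (Finset.univ.filter fun a : Fin (2 ^ b) => a.val % q = c).card ≤
        (Finset.range (2 ^ b / q + 1)).card := by
      refine Finset.card_le_card_of_injOn (fun a => a.val / q) ?_ ?_
      · intro a _
        simpa [Nat.lt_succ_iff] using Nat.div_le_div_right a.2.le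
      · intro a ha a' ha' haa
        have e1 : a.val % q = c := by simpa using ha
        have e2 : a'.val % q = c := by simpa using ha'
        have haa' : a.val / q = a'.val / q := haa
        apply Fin.ext
        rw [← Nat.div_add_mod a.val q, ← Nat.div_add_mod a'.val q, haa', e1, e2]
    simpa using h2
  have h3 : ((Finset.univ.filter fun a : Fin (2 ^ b) => a.val % q = c).card : ℝ) ≤
      2 ^ b / q + 1 := by
    have h4 : ((2 ^ b / q : ℕ) : ℝ) ≤ 2 ^ b / q := by
      exact_mod_cast (Nat.cast_div_le (α := ℝ) (m := 2 ^ b) (n := q))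
    have h5 : ((Finset.univ.filter fun a : Fin (2 ^ b) => a.val % q = c).card : ℝ) ≤
        ((2 ^ b / q : ℕ) : ℝ) + 1 := by exact_mod_cast h1
    linarith
  have hN : (0 : ℝ) < 2 ^ b := by positivity
  push_cast
  rw [div_le_iff₀ hN]
  refine h3.trans (le_of_eq ?_)
  field_simp

/-- With the colors of all other devices fixed, final or not, the fresh candidate of `v` has at most
`Δ ^ 2` values to avoid. -/
theorem expect_conflict_le {Δ : ℕ} (hG : ∀ v, (nbrs G v).card ≤ Δ) (hq : 0 < q)
    (s : V → DevState × Finset DevState) {v : V} (hv : ¬ (states s v).done = true) :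
    𝔼 x : V → Fin (2 ^ b), ind (fun x => ¬ ∀ u, (plusSquare G).Adj v u →
      (states (globalSlot G (think (chooseColor q)) s x) u).col ≠
        (states (globalSlot G (think (chooseColor q)) s x) v).col) x ≤
      Δ ^ 2 * (1 / q + 1 / 2 ^ b) := by
  have hv' : (s v).1.done = false := by simpa [states] using hv
  rw [expect_update _ v]
  refine (Finset.expect_le_expect (g := fun _ => (Δ ^ 2 * (1 / q + 1 / 2 ^ b) : ℝ))
    fun x _ => ?_).trans_eq (Fintype.expect_const _)
  set col : V → ℕ := fun u => if (s u).1.done then (s u).1.col else (x u).val % q with hcol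
  have h1 : ∀ a : Fin (2 ^ b), ind (fun x => ¬ ∀ u, (plusSquare G).Adj v u →
      (states (globalSlot G (think (chooseColor q)) s x) u).col ≠
        (states (globalSlot G (think (chooseColor q)) s x) v).col) (Function.update x v a) ≤
      ∑ u ∈ nbrs (plusSquare G) v, if a.val % q = col u then (1 : ℝ) else 0 := by
    intro a
    have h0 : ∀ u, (0 : ℝ) ≤ if a.val % q = col u then (1 : ℝ) else 0 := by
      intro u; split_ifs <;> norm_num
    by_cases hc : ∃ u, (plusSquare G).Adj v u ∧ a.val % q = col u
    · obtain ⟨u, hu, hc⟩ := hc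
      have h2 : (if a.val % q = col u then (1 : ℝ) else 0) = 1 := if_pos hc
      refine (ind_le_one _ _).trans (h2.ge.trans ?_)
      exact Finset.single_le_sum (f := fun u => if a.val % q = col u then (1 : ℝ) else 0)
        (fun u _ => h0 u) (mem_nbrs.mpr hu)
    · push Not at hc
      rw [ind_of_not]
      · exact Finset.sum_nonneg fun u _ => h0 u
      · rw [not_not]
        intro u hu
        have := hc u hu
        simp only [states, globalSlot_think, DevState.chooseColor, Function.update_self, hv',
          Function.update_of_ne hu.ne']
        exact fun h => this (by simpa [hcol] using h.symm)
  refine (Finset.expect_le_expect fun a _ => h1 a).trans ?_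
  rw [Finset.expect_sum_comm]
  have hpos : (0 : ℝ) ≤ 1 / q + 1 / 2 ^ b := by positivity
  refine (Finset.sum_le_card_nsmul _ _ _ fun u _ => expect_mod_eq_le hq _).trans ?_
  rw [nsmul_eq_mul]
  refine mul_le_mul_of_nonneg_right ?_ hpos
  exact_mod_cast card_nbrs_plusSquare_le hG v

/-- A conflict accounts for `5 / 8` and lost messages for `1 / 8`. Since final devices stay final,
the bound holds with the indicator on the right and can be iterated. -/
theorem wp_phase_le {Δ D m : ℕ} (hD : 2 ^ b = h * D) (hDΔ : 2 * Δ ≤ D)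
    (hG : ∀ v, (nbrs G v).card ≤ Δ) (hq : 0 < q)
    (hconf : (Δ : ℝ) ^ 2 * (1 / q + 1 / 2 ^ b) ≤ 5 / 8)
    (hm : ((Δ : ℝ) ^ 2 + Δ) * (1 / 2) ^ m ≤ 1 / 8)
    {s : V → DevState × Finset DevState} (hs : PhaseInv G q (states s)) (v : V) :
    wp (globalProgram G (phase b h q (2 * D * m))) (ind fun s' => ¬ (states s' v).done = true) s ≤
      3 / 4 * ind (fun s => ¬ (states s v).done = true) s := by
  by_cases hv : (states s v).done = true
  · rw [ind_of_not (s := s) (by simpa using hv), mul_zero]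
    refine wp_le_const (surely_phase hs hq) fun s' hs' => ?_
    exact (ind_of_not (by simpa using hs'.2 v hv)).le
  · rw [ind_of (s := s) hv, mul_one]
    change 𝔼 x, wp (globalProgram G (phaseTail b h (2 * D * m))) _ (globalSlot G _ s x) ≤ _
    set B : (V → Fin (2 ^ b)) → Prop := fun x => ¬ ∀ u, (plusSquare G).Adj v u →
      (states (globalSlot G (think (chooseColor q)) s x) u).col ≠
        (states (globalSlot G (think (chooseColor q)) s x) v).col with hB
    refine (Finset.expect_le_expect (g := fun x => ind B x + 1 / 8) fun x _ => ?_).trans ?_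
    · by_cases hx : B x
      · rw [ind_of hx]
        have := wp_le_const (p := globalProgram G (phaseTail b h (2 * D * m)))
          (Q := fun _ => True) (s := globalSlot G (think (chooseColor q)) s x)
          (surely_of_invariant trivial fun _ _ _ _ _ => trivial)
          fun s _ => ind_le_one (fun s' => ¬ (states s' v).done = true) s
        linarith
      · rw [ind_of_not hx, zero_add]
        exact (wp_phaseTail_le hD hDΔ hG (s := globalSlot G (think (chooseColor q)) s x)
          (hs.chooseColor hq x (buffers s)) (fun _ => rfl) v (not_not.mp hx)).trans hm
    · rw [Finset.expect_add_distrib, Fintype.expect_const]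
      have := (expect_conflict_le (b := b) hG hq s hv).trans hconf
      linarith

theorem wp_phases_le {Δ D m : ℕ} (hD : 2 ^ b = h * D) (hDΔ : 2 * Δ ≤ D)
    (hG : ∀ v, (nbrs G v).card ≤ Δ) (hq : 0 < q)
    (hconf : (Δ : ℝ) ^ 2 * (1 / q + 1 / 2 ^ b) ≤ 5 / 8)
    (hm : ((Δ : ℝ) ^ 2 + Δ) * (1 / 2) ^ m ≤ 1 / 8)
    {s : V → DevState × Finset DevState} (hs : PhaseInv G q (states s)) (v : V) :
    wp (globalProgram G (List.replicate K (phase b h q (2 * D * m))).flatten)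
      (ind fun s' => ¬ (states s' v).done = true) s ≤ (3 / 4) ^ K := by
  have key : ∀ s : V → DevState × Finset DevState, PhaseInv G q (states s) →
      wp (globalProgram G (List.replicate K (phase b h q (2 * D * m))).flatten)
        (ind fun s' => ¬ (states s' v).done = true) s ≤
        (3 / 4) ^ K * ind (fun s' => ¬ (states s' v).done = true) s := by
    induction K with
    | zero => intro s _; simp [globalProgram]
    | succ K ih =>
      intro s hs
      have h1 : globalProgram G (List.replicate (K + 1) (phase b h q (2 * D * m))).flatten =
          globalProgram G (phase b h q (2 * D * m)) ++
            globalProgram G (List.replicate K (phase b h q (2 * D * m))).flatten := by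
        simp [globalProgram, List.replicate_succ]
      rw [h1, wp_append]
      refine (wp_le_wp (surely_phase hs hq) fun s' hs' => ih s' hs'.1).trans ?_
      rw [wp_mul, pow_succ, mul_assoc ((3 / 4 : ℝ) ^ K)]
      refine mul_le_mul_of_nonneg_left (wp_phase_le hD hDΔ hG hq hconf hm hs v) ?_
      positivity
  exact (key s hs).trans (mul_le_of_le_one_right (by positivity) (ind_le_one _ _))

theorem expect_apply_eq_le {u v : V} (huv : u ≠ v) :
    𝔼 x : V → Fin (2 ^ b), ind (fun x => x u = x v) x ≤ 1 / 2 ^ b := by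
  rw [expect_update _ u]
  refine (Finset.expect_le_expect (g := fun _ => (1 / 2 ^ b : ℝ)) fun x _ => ?_).trans_eq
    (Fintype.expect_const _)
  simp only [ind, Function.update_self, Function.update_of_ne huv.symm]
  rw [Fintype.expect_eq_sum_div_card, Finset.sum_boole]
  simp [Finset.filter_eq']

/-- The devices have a proper coloring, and their buffers show the colors of their neighbours. -/
structure Colored (G : SimpleGraph V) (q Δ : ℕ) (s : V → DevState × Finset DevState) : Prop where
  isColoring : IsColoring (plusSquare G) q fun v => (s v).1.col
  mem_image : ∀ v w, G.Adj v w → (s w).1.col ∈ (s v).2.image DevState.col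
  card_le : ∀ v, ((s v).2.image DevState.col).card ≤ Δ

theorem wp_exchange_all_le {κ : Type*} [Encodable κ] {Δ D : ℕ} (hD : 2 ^ b = h * D)
    (hDΔ : 2 * Δ ≤ D) (hG : ∀ v, (nbrs G v).card ≤ Δ) (m : ℕ) (s : V → κ × Finset κ) :
    wp (globalProgram G (List.replicate (2 * D * m) (exchange (b := b) h)))
      (ind fun s' => ¬ ∀ v w, G.Adj v w → states s w ∈ (s' v).2) s ≤
      Fintype.card V ^ 2 * (1 / 2) ^ m := by
  classical
  set T : Finset (V × V) := Finset.univ.filter fun p => G.Adj p.1 p.2 with hT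
  refine le_trans (le_of_eq ?_) ((wp_exchange_exists_le G hD hDΔ hG T ?_ m s).trans ?_)
  · congr 2
    ext s'
    simp [hT]
  · simp [hT]
  · refine mul_le_mul_of_nonneg_right ?_ (by positivity)
    have h1 : T.card ≤ Fintype.card V ^ 2 := by
      rw [sq, ← Fintype.card_prod]
      exact Finset.card_le_univ _
    exact_mod_cast h1

/-- The four terms stand for a coincidence of identifiers, a loss in the first exchange, a device
unfinished after `K` phases, and a loss in the last exchange. -/
theorem wp_coloringProgram_le {Δ D m m' : ℕ} (hD : 2 ^ b = h * D) (hDΔ : 2 * Δ ≤ D)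
    (hG : ∀ v, (nbrs G v).card ≤ Δ) (hq : 0 < q)
    (hconf : (Δ : ℝ) ^ 2 * (1 / q + 1 / 2 ^ b) ≤ 5 / 8)
    (hm : ((Δ : ℝ) ^ 2 + Δ) * (1 / 2) ^ m ≤ 1 / 8) :
    wp (globalProgram G (coloringProgram b h q (2 * D * m) (2 * D * m') K))
      (ind fun s' => ¬ Colored G q Δ s') (fun _ => (⟨0, 0, false, ∅, ∅⟩, ∅)) ≤
      (Fintype.card V ^ 2 * (1 / 2 ^ b) : ℝ) + (Fintype.card V ^ 2 * (1 / 2) ^ m' +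
        (Fintype.card V * (3 / 4) ^ K + Fintype.card V ^ 2 * (1 / 2) ^ m')) := by
  set s₀ : V → DevState × Finset DevState := fun _ => (⟨0, 0, false, ∅, ∅⟩, ∅) with hs₀
  have e1 : globalProgram G (coloringProgram b h q (2 * D * m) (2 * D * m') K) =
      [globalSlot G (think chooseId)] ++
        (globalProgram G (List.replicate (2 * D * m') (exchange h)) ++
          globalSlot G (think learn) ::
            (globalProgram G (List.replicate K (phase b h q (2 * D * m))).flatten ++
              globalSlot G (think keep) ::
                globalProgram G (List.replicate (2 * D * m') (exchange h)))) := by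
    simp [globalProgram, coloringProgram]
  rw [e1]
  -- the identifiers are distinct
  refine wp_append_le (ind_le_one _)
    (Q := fun s => (∀ v, (s v).2 = ∅) ∧ ∀ v, (s v).1.done = false ∧ (s v).1.col = 0)
    (R := fun s => Function.Injective fun v => (s v).1.id)
    (fun x => ⟨fun _ => rfl, fun _ => ⟨rfl, rfl⟩⟩) ?_ (by positivity) ?_
  · set T : Finset (V × V) := Finset.univ.filter fun p => p.1 ≠ p.2 with hT
    rw [wp_cons]
    refine (Finset.expect_le_expect (g := fun x => ∑ p ∈ T, ind (fun x => x p.1 = x p.2) x)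
      fun x _ => ?_).trans ?_
    · refine le_trans (le_of_eq ?_) (ind_exists_le T _ x)
      simp only [wp_nil, ind]
      congr 1
      simp only [Function.Injective, hT, globalSlot_think, chooseId, hs₀, eq_iff_iff,
        Finset.mem_filter, Finset.mem_univ, true_and, Prod.exists, ne_eq]
      push Not
      simp only [Fin.val_inj, and_comm]
    · rw [Finset.expect_sum_comm]
      refine (Finset.sum_le_card_nsmul T _ (1 / 2 ^ b) fun p hp =>
        expect_apply_eq_le (by simpa [hT] using hp)).trans ?_
      rw [nsmul_eq_mul]
      refine mul_le_mul_of_nonneg_right ?_ (by positivity)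
      have h1 : T.card ≤ Fintype.card V ^ 2 := by
        rw [sq, ← Fintype.card_prod]
        exact Finset.card_le_univ _
      exact_mod_cast h1
  rintro s₁ ⟨hempty, hinit⟩ hinj
  -- all devices hear their neighbours
  refine wp_append_le (ind_le_one _) (surely_exchange_of_empty G hempty)
    (R := fun s => ∀ v w, G.Adj v w → states s₁ w ∈ (s v).2)
    (wp_exchange_all_le hD hDΔ hG m' s₁) (by positivity) ?_
  rintro s₂ ⟨hs₂, hsub⟩ hall
  rw [wp_cons]
  refine (Finset.expect_le_expect fun x _ => ?_).trans_eq (Fintype.expect_const _)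
  set s₃ := globalSlot G (think learn) s₂ x with hs₃
  have h3 : ∀ v, (s₃ v).1 = { (s₁ v).1 with nb := (s₂ v).2.image DevState.id } := by
    intro v
    have : (s₂ v).1 = (s₁ v).1 := congrFun hs₂ v
    rw [← this]
    rfl
  -- No color is final yet, so `proper` is vacuous; the default color `0` is below `q`.
  have hinv : PhaseInv G q (states s₃) := by
    refine ⟨⟨?_, fun v j => ?_⟩, fun v => ?_, fun u v _ hu _ => ?_⟩
    · simpa only [states, h3] using hinj
    · simp only [states, h3, Finset.mem_image]
      constructor
      · rintro ⟨k, hk, rfl⟩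
        obtain ⟨u, hu, rfl⟩ := hsub v k hk
        exact ⟨u, hu, rfl⟩
      · rintro ⟨w, hw, rfl⟩
        exact ⟨_, hall v w hw, rfl⟩
    · simpa only [states, h3, (hinit v).2] using hq
    · simp [states, h3, (hinit u).1] at hu
  -- all colors become final
  refine wp_append_le (ind_le_one _) (surely_phases hinv hq)
    (R := fun s => ∀ v, (states s v).done = true) ?_ (by positivity) ?_
  · refine le_trans (le_of_eq ?_) (wp_ind_exists_le (Finset.univ : Finset V) _
      (fun v (s : V → DevState × Finset DevState) => ¬ (states s v).done = true) _
      fun v _ => wp_phases_le hD hDΔ hG hq hconf hm hinv v)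
    congr 2
    ext s
    simp
  intro s₄ hs₄ hdone
  rw [wp_cons]
  refine (Finset.expect_le_expect fun y _ => ?_).trans_eq (Fintype.expect_const _)
  have hkeep : states (globalSlot G (think keep) s₄ y) = states s₄ := rfl
  -- Appending the empty program lets `wp_append_le` treat the last exchange too.
  rw [← add_zero ((Fintype.card V : ℝ) ^ 2 * (1 / 2) ^ m'),
    ← List.append_nil (globalProgram G (List.replicate _ _))]
  refine wp_append_le (ind_le_one _) (surely_exchange_of_empty G fun _ => rfl)
    (wp_exchange_all_le hD hDΔ hG m' (globalSlot G (think keep) s₄ y)) le_rfl ?_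
  rintro s₅ ⟨hs₅, hsub₅⟩ hall₅
  rw [hkeep] at hs₅ hsub₅ hall₅
  rw [wp_nil, ind_of_not]
  rw [not_not]
  refine ⟨⟨fun v => ?_, fun u v huv => ?_⟩, fun v w hvw => ?_, fun v => ?_⟩
  · change (states s₅ v).col < q
    rw [hs₅]
    exact hs₄.col_lt v
  · change (states s₅ u).col ≠ (states s₅ v).col
    rw [hs₅]
    exact hs₄.proper u v huv (hdone u) (hdone v)
  · change (states s₅ w).col ∈ _
    rw [hs₅]
    exact Finset.mem_image_of_mem _ (hall₅ v w hvw)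
  · have h1 : (s₅ v).2.image DevState.col ⊆ (nbrs G v).image fun w => (states s₄ w).col := by
      intro c hc
      obtain ⟨k, hk, rfl⟩ := Finset.mem_image.mp hc
      obtain ⟨u, hu, rfl⟩ := hsub₅ v k hk
      exact Finset.mem_image_of_mem (fun w => (states s₄ w).col) (mem_nbrs.mpr hu)
    exact (Finset.card_le_card h1).trans (Finset.card_image_le.trans (hG v))

end

/-! ## The coloring protocol -/

instance : MeasurableSpace (Finset ℕ) := ⊤

instance : DiscreteMeasurableSpace (Finset ℕ) := ⟨fun _ => trivial⟩

/-- The pairs of a color and of a set of colors from which the neighbours are heard. -/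
structure Ready {V : Type*} (G : SimpleGraph V) (q : ℕ) (o : V → ℕ × Finset ℕ) : Prop where
  isColoring : IsColoring (plusSquare G) q fun v => (o v).1
  mem : ∀ v w, G.Adj v w → (o w).1 ∈ (o v).2

/-- The output of the coloring program: the color and the colors of the neighbours. -/
def coloringOutput (Δ : ℕ) (s : DevState × Finset DevState) : ℕ × Finset ℕ :=
  (s.1.col, if (s.2.image DevState.col).card ≤ Δ then s.2.image DevState.col else ∅)

/-- The truncation in `coloringOutput` bounds the list even when the coloring fails, as the energy
bound must hold on every execution. -/
theorem card_coloringOutput_le (Δ : ℕ) (s : DevState × Finset DevState) :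
    (coloringOutput Δ s).2.card ≤ Δ := by
  unfold coloringOutput
  split_ifs with h
  · exact h
  · simp

theorem Colored.ready {V : Type*} {G : SimpleGraph V} {q Δ : ℕ}
    {s : V → DevState × Finset DevState} (h : Colored G q Δ s) :
    Ready G q fun v => coloringOutput Δ (s v) := by
  refine ⟨h.isColoring, fun v w hvw => ?_⟩
  simp only [coloringOutput, if_pos (h.card_le v)]
  exact h.mem_image v w hvw

theorem IsNetwork.card_nbrs_le {V : Type*} [Fintype V] {Δ : ℕ} {G : SimpleGraph V}
    (hG : IsNetwork Δ G) (v : V) : (nbrs G v).card ≤ Δ := by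
  classical
  refine le_trans (le_of_eq ?_) (hG.2 v)
  rw [← SimpleGraph.card_neighborFinset_eq_degree]
  congr 1
  ext w
  simp

/-- A connected graph has at least `n - 1` edges. This forces `n ≤ 2` for `Δ = 1` and `n ≤ 1` for `Δ
= 0`. -/
theorem IsNetwork.card_le {n Δ : ℕ} {G : SimpleGraph (Fin n)} (hG : IsNetwork Δ G) :
    2 * n ≤ n * Δ + 2 := by
  classical
  have h1 := hG.1.card_vert_le_card_edgeSet_add_one
  have h2 := G.sum_degrees_eq_twice_card_edges
  have h3 : ∑ v, G.degree v ≤ n * Δ := by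
    refine (Finset.sum_le_card_nsmul _ _ Δ fun v _ => ?_).trans (by simp)
    convert hG.2 v
  rw [Nat.card_eq_fintype_card, Fintype.card_fin, Nat.card_eq_fintype_card,
    ← SimpleGraph.edgeFinset_card] at h1
  omega

theorem half_pow_clog_le {n : ℕ} (hn : 1 ≤ n) (k : ℕ) :
    (1 / 2 : ℝ) ^ (k * Nat.clog 2 n) ≤ (1 / n) ^ k := by
  have h1 : (n : ℝ) ≤ 2 ^ Nat.clog 2 n := by exact_mod_cast Nat.le_pow_clog (by norm_num) n
  have hn0 : (0 : ℝ) < n := by exact_mod_cast hn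
  rw [mul_comm, pow_mul]
  refine pow_le_pow_left₀ (by positivity) ?_ k
  rw [one_div_pow]
  exact one_div_le_one_div_of_le hn0 h1

/-- The ceiling costs at most one, which is at most `log n / log 2`; finally `log 2 > 1 / 2`. -/
theorem clog_le_log {n : ℕ} (hn : 2 ≤ n) : (Nat.clog 2 n : ℝ) ≤ 4 * Real.log n := by
  have h1 := Nat.pow_pred_clog_lt_self (b := 2) (by norm_num) (x := n) (by omega)
  have h2 : 1 ≤ Nat.clog 2 n := Nat.clog_pos (by norm_num) hn
  have hl2 : (1 / 2 : ℝ) < Real.log 2 := by linarith [Real.log_two_gt_d9]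
  have h3 : Real.log 2 ≤ Real.log n := Real.log_le_log (by norm_num) (by exact_mod_cast hn)
  have h4 : ((Nat.clog 2 n).pred : ℝ) * Real.log 2 ≤ Real.log n := by
    rw [← Real.log_pow]
    exact Real.log_le_log (by positivity) (by exact_mod_cast h1.le)
  have h5 : ((Nat.clog 2 n).pred : ℝ) + 1 = Nat.clog 2 n := by
    exact_mod_cast Nat.succ_pred_eq_of_pos h2
  have h6 : (0 : ℝ) ≤ Nat.clog 2 n := by positivity
  nlinarith

/-- The error probability of the coloring program, for the parameters chosen below. -/
theorem coloring_error_le {n c : ℕ} (hn : 2 ≤ n) :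
    ((n : ℝ) ^ 2 * (1 / 2) ^ ((c + 5) * Nat.clog 2 n) +
      (n ^ 2 * (1 / 2) ^ ((c + 5) * Nat.clog 2 n) +
        (n * (3 / 4) ^ (3 * ((c + 4) * Nat.clog 2 n)) +
          n ^ 2 * (1 / 2) ^ ((c + 5) * Nat.clog 2 n)))) ≤ 1 / n ^ c := by
  have hn0 : (2 : ℝ) ≤ n := by exact_mod_cast hn
  have h1 := half_pow_clog_le (n := n) (by omega) (c + 5)
  have h2 := half_pow_clog_le (n := n) (by omega) (c + 4)
  -- `(3 / 4) ^ 3 = 27 / 64 ≤ 1 / 2` explains the factor `3` in the number of phases.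
  have h3 : (3 / 4 : ℝ) ^ (3 * ((c + 4) * Nat.clog 2 n)) ≤
      (1 / 2) ^ ((c + 4) * Nat.clog 2 n) := by
    rw [pow_mul]
    exact pow_le_pow_left₀ (by norm_num) (by norm_num) _
  set y : ℝ := 1 / n with hy
  have hny : (n : ℝ) * y = 1 := by rw [hy]; field_simp
  have hy0 : 0 < y := by positivity
  have hy2 : y ≤ 1 / 2 := one_div_le_one_div_of_le (by norm_num) hn0
  have e1 : (n : ℝ) ^ 2 * y ^ (c + 5) = y ^ c * y ^ 3 := by
    calc (n : ℝ) ^ 2 * y ^ (c + 5) = (n * y) ^ 2 * (y ^ c * y ^ 3) := by ring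
      _ = _ := by rw [hny]; ring
  have e2 : (n : ℝ) * y ^ (c + 4) = y ^ c * y ^ 3 := by
    calc (n : ℝ) * y ^ (c + 4) = (n * y) * (y ^ c * y ^ 3) := by ring
      _ = _ := by rw [hny]; ring
  have e3 : (1 : ℝ) / n ^ c = y ^ c := by rw [hy, one_div_pow]
  -- Each of the four error terms is at most `y ^ c * y ^ 3`, so a quarter of the allowed error
  -- suffices.
  have e4 : y ^ 3 ≤ 1 / 4 := by
    have := pow_le_pow_left₀ hy0.le hy2 3
    norm_num at this ⊢
    linarith
  have e5 : y ^ c * y ^ 3 ≤ y ^ c * (1 / 4) := mul_le_mul_of_nonneg_left e4 (by positivity)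
  have f1 : (n : ℝ) ^ 2 * (1 / 2) ^ ((c + 5) * Nat.clog 2 n) ≤ y ^ c * y ^ 3 :=
    e1 ▸ mul_le_mul_of_nonneg_left h1 (by positivity)
  have f2 : (n : ℝ) * (3 / 4) ^ (3 * ((c + 4) * Nat.clog 2 n)) ≤ y ^ c * y ^ 3 :=
    e2 ▸ mul_le_mul_of_nonneg_left (h3.trans h2) (by positivity)
  rw [e3]
  linarith

/-- A coloring protocol from which the devices also learn the colors of their neighbours. -/
theorem exists_coloring_protocol (c n Δ : ℕ) (hn : 2 ≤ n) (hΔ : 2 ≤ Δ) :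
    ∃ (P : Protocol NoCD Unit (ℕ × Finset ℕ)) (T₀ : ℕ), P.HalfDuplex ∧
      (T₀ : ℝ) ≤ 64 * (85 * c + 347) * (Δ * Real.log Δ * Real.log n) ∧
      (∀ u r h, (P.output u r h).2.card ≤ Δ) ∧
      ∀ G : SimpleGraph (Fin n), IsNetwork Δ G →
        tapesMeasure (Fin n) {r | ¬ Ready G (2 * Δ ^ 2) (P.result G (fun _ => ()) r T₀)} ≤
          ENNReal.ofReal (1 / (n : ℝ) ^ c) := by
  set l := Nat.clog 2 Δ with hl
  set k := Nat.clog 2 n with hk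
  have hl1 : 1 ≤ l := Nat.clog_pos (by norm_num) hΔ
  have hk1 : 1 ≤ k := Nat.clog_pos (by norm_num) hn
  have hΔl : Δ ≤ 2 ^ l := Nat.le_pow_clog (by norm_num) Δ
  -- Sending has probability `h / 2 ^ b = 1 / D`. The range `2 ^ b` is at least `8 * Δ ^ 2`, for
  -- nearly uniform colors, and at least `n ^ (c + 5)`, for distinct identifiers. The exchanges of a
  -- phase need only constant reliability, hence `m` of order `log Δ`; the outer ones must reach
  -- every device, hence `m'` of order `log n`.
  set D := 2 ^ (l + 1) with hD
  set h := 2 ^ (2 * l + 3 + (c + 5) * k) with hh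
  set b := (2 * l + 3 + (c + 5) * k) + (l + 1) with hb
  set m := 2 * l + 4 with hm
  set m' := (c + 5) * k with hm'
  set K := 3 * ((c + 4) * k) with hK
  have hbD : 2 ^ b = h * D := pow_add _ _ _
  have hDΔ : 2 * Δ ≤ D := by rw [hD, pow_succ]; omega
  have hD1 : 1 ≤ D := Nat.one_le_two_pow
  have hq : 0 < 2 * Δ ^ 2 := by positivity
  have hΔ0 : (2 : ℝ) ≤ Δ := by exact_mod_cast hΔ
  have hΔsq : (Δ : ℝ) ^ 2 ≤ 2 ^ (2 * l) := by
    rw [mul_comm, pow_mul]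
    exact pow_le_pow_left₀ (by positivity) (by exact_mod_cast hΔl) 2
  have hconf : (Δ : ℝ) ^ 2 * (1 / ((2 * Δ ^ 2 : ℕ) : ℝ) + 1 / 2 ^ b) ≤ 5 / 8 := by
    have h1 : (Δ : ℝ) ^ 2 * (1 / ((2 * Δ ^ 2 : ℕ) : ℝ)) = 1 / 2 := by
      push_cast
      field_simp
    have h2 : (8 : ℝ) * Δ ^ 2 ≤ 2 ^ b := by
      calc (8 : ℝ) * Δ ^ 2 ≤ 8 * 2 ^ (2 * l) := by linarith
        _ = 2 ^ (2 * l + 3) := by rw [pow_add]; norm_num; ring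
        _ ≤ 2 ^ b := pow_le_pow_right₀ (by norm_num) (by omega)
    have h3 : (Δ : ℝ) ^ 2 * (1 / 2 ^ b) ≤ 1 / 8 := by
      rw [mul_one_div, div_le_iff₀ (by positivity)]
      linarith
    rw [mul_add, h1]
    linarith
  have hmm : ((Δ : ℝ) ^ 2 + Δ) * (1 / 2) ^ m ≤ 1 / 8 := by
    have h1 : (Δ : ℝ) ^ 2 + Δ ≤ 2 * 2 ^ (2 * l) := by nlinarith
    have h2 : (2 : ℝ) * 2 ^ (2 * l) * (1 / 2) ^ m = 1 / 8 := by
      rw [hm, pow_add, one_div_pow]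
      field_simp
      norm_num
    exact (mul_le_mul_of_nonneg_right h1 (by positivity)).trans h2.le
  set p := coloringProgram b h (2 * Δ ^ 2) (2 * D * m) (2 * D * m') K with hp
  refine ⟨programProtocol p (⟨0, 0, false, ∅, ∅⟩, ∅) (coloringOutput Δ), p.length,
    programProtocol_halfDuplex _ _ _, ?_, fun _ _ _ => card_coloringOutput_le _ _, fun G hG => ?_⟩
  · rw [hp, length_coloringProgram]
    have h1 : 3 + 2 * (2 * D * m') + K * (3 + 2 * (2 * D * m)) ≤
        (85 * c + 347) * (D * l * k) := by
      -- Terms without the factor `l` are absorbed because `Δ ≥ 2` gives `l ≥ 1`.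
      have a1 : D * k ≤ D * l * k := Nat.mul_le_mul_right _ (Nat.le_mul_of_pos_right _ hl1)
      have a2 : k ≤ D * l * k := (Nat.le_mul_of_pos_left _ hD1).trans a1
      have a3 : 1 ≤ D * l * k := hk1.trans a2
      calc 3 + 2 * (2 * D * m') + K * (3 + 2 * (2 * D * m))
          = 3 * 1 + 4 * (c + 5) * (D * k) + 9 * (c + 4) * k +
            12 * (c + 4) * (2 * (D * l * k) + 4 * (D * k)) := by
            rw [hm, hm', hK]; ring
        _ ≤ 3 * (D * l * k) + 4 * (c + 5) * (D * l * k) + 9 * (c + 4) * (D * l * k) +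
            12 * (c + 4) * (2 * (D * l * k) + 4 * (D * l * k)) := by gcongr
        _ = (85 * c + 347) * (D * l * k) := by ring
    have h2 : D ≤ 4 * Δ := by
      have h3 := Nat.pow_pred_clog_lt_self (b := 2) (by norm_num) (x := Δ) (by omega)
      have h4 : l + 1 = (Nat.clog 2 Δ).pred + 2 := by
        rw [← hl]; simp only [Nat.pred_eq_sub_one]; omega
      rw [hD, h4, pow_add]
      omega
    have h3 := clog_le_log hΔ
    have h4 := clog_le_log hn
    rw [← hl] at h3
    rw [← hk] at h4
    have h5 : (D : ℝ) ≤ 4 * Δ := by exact_mod_cast h2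
    have h6 : (D : ℝ) * l * k ≤ (4 * Δ) * (4 * Real.log Δ) * (4 * Real.log n) := by gcongr
    calc ((3 + 2 * (2 * D * m') + K * (3 + 2 * (2 * D * m)) : ℕ) : ℝ)
        ≤ ((85 * c + 347) * (D * l * k) : ℕ) := by exact_mod_cast h1
      _ = (85 * c + 347) * ((D : ℝ) * l * k) := by push_cast; ring
      _ ≤ (85 * c + 347) * ((4 * Δ) * (4 * Real.log Δ) * (4 * Real.log n)) := by gcongr
      _ = _ := by ring
  · have hw := wp_coloringProgram_le (K := K) (m' := m') (G := G) hbD hDΔ hG.card_nbrs_le hq hconf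
      hmm
    have hsub : {r | ¬ Ready G (2 * Δ ^ 2) ((programProtocol p
        (⟨0, 0, false, ∅, ∅⟩, ∅) (coloringOutput Δ)).result G (fun _ => ()) r p.length)} ⊆
        {r | ¬ Colored G (2 * Δ ^ 2) Δ (exec (globalProgram G p) (fun _ => (⟨0, 0, false, ∅, ∅⟩, ∅)) r)} := by
      intro r hr hc
      refine hr ?_
      have h1 := hc.ready
      convert h1 using 1
      funext v
      exact programProtocol_result G _ _ _ r v
    refine (measure_mono hsub).trans ((tapesMeasure_exec (globalProgram G p)
      (fun s => ¬ Colored G (2 * Δ ^ 2) Δ s) (fun _ => (⟨0, 0, false, ∅, ∅⟩, ∅))).le.trans ?_)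
    refine ENNReal.ofReal_le_ofReal (hw.trans ?_)
    rw [Fintype.card_fin]
    have h1 : (1 : ℝ) / 2 ^ b ≤ (1 / 2) ^ m' := by
      rw [one_div_pow]
      exact one_div_le_one_div_of_le (by positivity)
        (pow_le_pow_right₀ (by norm_num) (by omega))
    have h2 := coloring_error_le (c := c) hn
    have h3 : (n : ℝ) ^ 2 * (1 / 2 ^ b) ≤ n ^ 2 * (1 / 2) ^ m' :=
      mul_le_mul_of_nonneg_left h1 (by positivity)
    rw [← hk, ← hm', ← hK] at h2
    linarith

/-- In a network of degree at most 1, random colors of a palette of constant size suffice. -/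
theorem exists_random_color_protocol (c n : ℕ) (hn : 2 ≤ n) :
    ∃ P : Protocol NoCD Unit (ℕ × Finset ℕ), P.HalfDuplex ∧
      (∀ u r h, (P.output u r h).2.card ≤ 2 ^ c) ∧
      ∀ G : SimpleGraph (Fin n), IsNetwork 1 G →
        tapesMeasure (Fin n) {r | ¬ Ready G (2 ^ c) (P.result G (fun _ => ()) r 0)} ≤
          ENNReal.ofReal (1 / (n : ℝ) ^ c) := by
  refine ⟨⟨fun _ _ _ => ⟨none, false⟩,
    fun _ r _ => ((sample c (tapeFst r)).val, Finset.range (2 ^ c)),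
    fun _ _ => measurable_const, fun _ _ => ?_⟩, fun _ _ _ => by simp, fun _ _ _ => by simp,
    fun G hG => ?_⟩
  · exact (measurable_of_countable fun y : Fin (2 ^ c) => (y.val, Finset.range (2 ^ c))).comp
      ((measurable_sample c).comp measurable_tapeFst)
  -- The network is a single edge, so only two colors have to differ; listing the whole palette
  -- makes `mem` automatic.
  · obtain rfl : n = 2 := by have := hG.card_le; omega
    have h1 := tapesMeasure_exec (V := Fin 2) (b := c) [fun _ x => x] (fun x => x 0 = x 1) 0
    have h2 : wp [fun (_ : Fin 2 → Fin (2 ^ c)) (x : Fin 2 → Fin (2 ^ c)) => x]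
        (ind fun x => x 0 = x 1) 0 ≤ 1 / 2 ^ c := expect_apply_eq_le (by decide)
    refine (measure_mono ?_).trans (h1.le.trans (ENNReal.ofReal_le_ofReal (by simpa using h2)))
    intro r hr
    by_contra hne
    refine hr ⟨⟨fun v => (sample c (tapeFst (r v))).2, fun u v huv => ?_⟩, fun v w _ => ?_⟩
    · have hne' : sample c (tapeFst (r 0)) ≠ sample c (tapeFst (r 1)) := hne
      intro heq
      have heq' : sample c (tapeFst (r u)) = sample c (tapeFst (r v)) := Fin.ext heq
      have huv' : u ≠ v := huv.1
      fin_cases u <;> fin_cases v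
      · exact huv' rfl
      · exact hne' heq'
      · exact hne' heq'.symm
      · exact huv' rfl
    · exact Finset.mem_range.mpr (sample c (tapeFst (r w))).2

end Coloring

end Protocols

/-! ## The simulation of a `LOCAL` algorithm -/

/-- The message heard in slot `i`, if any, according to the list `h` of perceptions. -/
def heardAt (h : List (Option (Option Message))) (i : ℕ) : Option Message := (h[i]?).join.join

instance : Countable SlotAction :=
  Function.Injective.countable (f := fun a : SlotAction => (a.send, a.listen)) <| by
    rintro ⟨s, l⟩ ⟨s', l'⟩ h
    simpa using h

instance : DiscreteMeasurableSpace SlotAction := ⟨fun _ => trivial⟩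

instance : MeasurableSpace (List (Option LOCAL.Feedback)) := ⊤

instance : DiscreteMeasurableSpace (List (Option LOCAL.Feedback)) := ⟨fun _ => trivial⟩

instance : Countable (List (Option LOCAL.Feedback)) :=
  inferInstanceAs (Countable (List (Option (Multiset (List Bool)))))

theorem multiset_filterMap_congr {α β : Type*} {f g : α → Option β} {s : Multiset α}
    (h : ∀ a ∈ s, f a = g a) : s.filterMap f = s.filterMap g := by
  induction s using Quot.inductionOn with
  | h l => exact congrArg _ (List.filterMap_congr h)

/-! ### The execution of `A` as reconstructed by one device -/

section Local

variable {I O : Type*} [MeasurableSpace O] (A : Protocol LOCAL I O) (x : I) (T₀ q : ℕ)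

/-- The history of `A` that a device reconstructs: slot `t` of `A` is simulated in the `q` slots
from `T₀ + t * q` on, and `e i` is the message heard in slot `i`. -/
def simHistory (ρ : Tape) (e : ℕ → Option Message) : ℕ → List (Option LOCAL.Feedback)
  | 0 => []
  | t + 1 => simHistory ρ e t ++
      [if (A.act x ρ (simHistory ρ e t)).listen then
        some ((Multiset.range q).filterMap fun j => e (T₀ + t * q + j))
      else none]

/-- The action of `A` in slot `t`, in the simulated execution. -/
def simAction (ρ : Tape) (e : ℕ → Option Message) (t : ℕ) : SlotAction :=
  A.act x ρ (simHistory A x T₀ q ρ e t)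

open Classical in
/-- The energy that `A` spends up to and including slot `t`, in the simulated execution. -/
noncomputable def simEnergy (ρ : Tape) (e : ℕ → Option Message) (t : ℕ) : ℕ :=
  ((Finset.range (t + 1)).filter fun t' => (simAction A x T₀ q ρ e t').Active).card

/-- The action in subslot `j` of a simulated slot in which `A` acts by `a`, having spent the energy
`N` out of a budget of `E`; the device has the color `o.1` and listens to the colors in `o.2`. -/
def subslotAction (E : ℕ) (o : ℕ × Finset ℕ) (N : ℕ) (a : SlotAction) (j : ℕ) : SlotAction :=
  if N ≤ E then
    if j = o.1 then ⟨a.send, false⟩ else ⟨none, a.listen && decide (j ∈ o.2)⟩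
  else ⟨none, false⟩

theorem subslotAction_halfDuplex (E : ℕ) (o : ℕ × Finset ℕ) (N : ℕ) (a : SlotAction) (j : ℕ) :
    ¬ ((subslotAction E o N a j).send.isSome = true ∧ (subslotAction E o N a j).listen = true) := by
  unfold subslotAction
  split_ifs <;> simp

theorem active_of_subslotAction {E : ℕ} {o : ℕ × Finset ℕ} {N : ℕ} {a : SlotAction} {j : ℕ}
    (h : (subslotAction E o N a j).Active) : N ≤ E ∧ a.Active ∧ j ∈ insert o.1 o.2 := by
  unfold subslotAction at h
  split_ifs at h with h1 h2
  · refine ⟨h1, Or.inl ?_, by simp [h2]⟩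
    simpa [SlotAction.Active] using h
  · have h3 : a.listen = true ∧ j ∈ o.2 := by simpa [SlotAction.Active] using h
    exact ⟨h1, Or.inr h3.1, Finset.mem_insert_of_mem h3.2⟩
  · simp [SlotAction.Active] at h

variable {A x T₀ q}

/-- Causality: the history of `A` before its slot `t` uses only what is heard before slot `T₀ + t *
q`, so it is available when that slot is simulated. -/
theorem simHistory_congr {ρ : Tape} {e e' : ℕ → Option Message} {t : ℕ}
    (h : ∀ i < T₀ + t * q, e i = e' i) :
    simHistory A x T₀ q ρ e t = simHistory A x T₀ q ρ e' t := by
  induction t with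
  | zero => rfl
  | succ t ih =>
    rw [Nat.succ_mul] at h
    have h1 := ih fun i hi => h i (by omega)
    have h2 : (Multiset.range q).filterMap (fun j => e (T₀ + t * q + j)) =
        (Multiset.range q).filterMap fun j => e' (T₀ + t * q + j) := by
      refine multiset_filterMap_congr fun j hj => h _ ?_
      have := Multiset.mem_range.mp hj
      omega
    rw [simHistory, simHistory, h1, h2]

theorem simAction_congr {ρ : Tape} {e e' : ℕ → Option Message} {t : ℕ}
    (h : ∀ i < T₀ + t * q, e i = e' i) :
    simAction A x T₀ q ρ e t = simAction A x T₀ q ρ e' t := by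
  rw [simAction, simAction, simHistory_congr h]

theorem simEnergy_congr {ρ : Tape} {e e' : ℕ → Option Message} {t : ℕ}
    (h : ∀ i < T₀ + t * q, e i = e' i) :
    simEnergy A x T₀ q ρ e t = simEnergy A x T₀ q ρ e' t := by
  classical
  unfold simEnergy
  congr 1
  refine Finset.filter_congr fun t' ht' => ?_
  rw [simAction_congr fun i hi => h i (hi.trans_le ?_)]
  have : t' ≤ t := by simpa [Nat.lt_succ_iff] using ht'
  gcongr

open Classical in
-- At the last counted slot the energy, that slot included, is at most `E`, and it already covers
-- all the earlier ones.
theorem card_active_le (E T : ℕ) (ρ : Tape) (e : ℕ → Option Message) :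
    ((Finset.range T).filter fun t => simEnergy A x T₀ q ρ e t ≤ E ∧
      (simAction A x T₀ q ρ e t).Active).card ≤ E := by
  set F := (Finset.range T).filter fun t => simEnergy A x T₀ q ρ e t ≤ E ∧
      (simAction A x T₀ q ρ e t).Active with hF
  rcases F.eq_empty_or_nonempty with h0 | hne
  · simp [h0]
  · have h1 := (Finset.mem_filter.mp (F.max'_mem hne)).2.1
    refine le_trans (Finset.card_le_card fun t ht => ?_) h1
    refine Finset.mem_filter.mpr ⟨?_, (Finset.mem_filter.mp ht).2.2⟩
    exact Finset.mem_range.mpr (Nat.lt_succ_of_le (F.le_max' t ht))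

/-- Protocols are measurable for each fixed history, while the reconstructed history depends on the
tape; `LOCAL` histories being countable, this closes the gap. -/
theorem measurable_of_countable_family {α β : Type*} [MeasurableSpace α] [MeasurableSpace β]
    [Countable β] [MeasurableSingletonClass β] {γ : Type*} [MeasurableSpace γ] {f : α → β → γ}
    {g : α → β} (hf : ∀ y, Measurable fun a => f a y) (hg : Measurable g) :
    Measurable fun a => f a (g a) :=
  (measurable_from_prod_countable_left (f := fun p : α × β => f p.1 p.2) hf).comp
    (measurable_id.prodMk hg)

theorem measurable_simHistory {ρ : Tape → Tape} (hρ : Measurable ρ) (e : ℕ → Option Message)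
    (t : ℕ) : Measurable fun r => simHistory A x T₀ q (ρ r) e t := by
  induction t with
  | zero => exact measurable_const
  | succ t ih =>
    have h1 : Measurable fun r => A.act x (ρ r) (simHistory A x T₀ q (ρ r) e t) :=
      measurable_of_countable_family (f := fun r h => A.act x (ρ r) h)
        (fun h => (A.measurable_act x h).comp hρ) ih
    exact (measurable_of_countable fun p : List (Option LOCAL.Feedback) × SlotAction =>
      p.1 ++ [if p.2.listen then
        some ((Multiset.range q).filterMap fun j => e (T₀ + t * q + j)) else none]).comp
      (ih.prodMk h1)

theorem measurable_simAction {ρ : Tape → Tape} (hρ : Measurable ρ) (e : ℕ → Option Message)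
    (t : ℕ) : Measurable fun r => simAction A x T₀ q (ρ r) e t :=
  measurable_of_countable_family (f := fun r h => A.act x (ρ r) h)
    (fun h => (A.measurable_act x h).comp hρ) (measurable_simHistory hρ e t)

theorem measurable_simEnergy {ρ : Tape → Tape} (hρ : Measurable ρ) (e : ℕ → Option Message)
    (t : ℕ) : Measurable fun r => simEnergy A x T₀ q (ρ r) e t := by
  classical
  unfold simEnergy
  simp only [Finset.card_filter]
  refine Finset.measurable_sum _ fun t' _ => ?_
  exact (measurable_of_countable fun a : SlotAction => if a.Active then 1 else 0).comp
    (measurable_simAction hρ e t')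

end Local

/-! ### The simulating protocol: actions, energy and correctness -/

section Simulation

variable {I O : Type*} [MeasurableSpace O]

/-- The simulation of `A`: the protocol `P` is executed for `T₀` slots; then each slot of `A` is
simulated in `q` slots, with the colors and the lists of colors computed by `P`, and at most `E`
energy is spent for actions of `A`. -/
noncomputable def simulation (A : Protocol LOCAL I O) (P : Protocol NoCD Unit (ℕ × Finset ℕ))
    (T₀ q T E : ℕ) : Protocol NoCD I O where
  act x r h :=
    if h.length < T₀ then P.act () (tapeSnd r) h
    else subslotAction E (P.output () (tapeSnd r) (h.take T₀))
      (simEnergy A x T₀ q (tapeFst r) (heardAt h) ((h.length - T₀) / q))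
      (simAction A x T₀ q (tapeFst r) (heardAt h) ((h.length - T₀) / q))
      ((h.length - T₀) % q)
  output x r h := A.output x (tapeFst r) (simHistory A x T₀ q (tapeFst r) (heardAt h) T)
  measurable_act x h := by
    split_ifs
    · exact (P.measurable_act () h).comp measurable_tapeSnd
    · exact (measurable_of_countable fun p : (ℕ × Finset ℕ) × ℕ × SlotAction =>
        subslotAction E p.1 p.2.1 p.2.2 ((h.length - T₀) % q)).comp
        (((P.measurable_output () _).comp measurable_tapeSnd).prodMk
          ((measurable_simEnergy measurable_tapeFst _ _).prodMk
            (measurable_simAction measurable_tapeFst _ _)))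
  measurable_output x h :=
    measurable_of_countable_family (f := fun r h => A.output x (tapeFst r) h)
      (fun h => (A.measurable_output x h).comp measurable_tapeFst)
      (measurable_simHistory measurable_tapeFst _ _)

variable {A : Protocol LOCAL I O} {P : Protocol NoCD Unit (ℕ × Finset ℕ)} {T₀ q T E : ℕ}

theorem simulation_halfDuplex (hP : P.HalfDuplex) : (simulation A P T₀ q T E).HalfDuplex := by
  intro x r h
  simp only [simulation]
  split_ifs
  · exact hP _ _ _
  · exact subslotAction_halfDuplex _ _ _ _ _

variable {V : Type*} [Fintype V]

section History

variable {J O' : Type*} [MeasurableSpace O'] (S : Protocol NoCD J O') (G : SimpleGraph V)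
  (x : V → J) (r : V → Tape)

/-- The message that `v` hears in slot `i`, if any. -/
noncomputable def heard (v : V) (i : ℕ) : Option Message :=
  (perceive G (S.action G x r i) v).join

theorem history_succ (t : ℕ) (v : V) : S.history G x r (t + 1) v =
    S.history G x r t v ++ [perceive G (S.action G x r t) v] := rfl

theorem length_history (t : ℕ) (v : V) : (S.history G x r t v).length = t := by
  induction t with
  | zero => rfl
  | succ t ih => rw [history_succ, List.length_append, ih]; rfl

theorem heardAt_history {t i : ℕ} (hi : i < t) (v : V) :
    heardAt (S.history G x r t v) i = heard S G x r v i := by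
  induction t with
  | zero => omega
  | succ t ih =>
    rw [history_succ, heardAt]
    rcases Nat.lt_succ_iff_lt_or_eq.mp hi with h | rfl
    · rw [List.getElem?_append_left (by rwa [length_history])]
      exact ih h
    · rw [List.getElem?_append_right (by rw [length_history]), length_history]
      simp [heard]

theorem take_history {s t : ℕ} (hst : s ≤ t) (v : V) :
    (S.history G x r t v).take s = S.history G x r s v := by
  induction t, hst using Nat.le_induction with
  | base => exact List.take_of_length_le (length_history S G x r s v).le
  | succ t hst ih =>
    rw [history_succ, List.take_append_of_le_length (by rwa [length_history]), ih]

end History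

variable (A P T₀ q T E) in
theorem simulation_history_eq (G : SimpleGraph V) (x : V → I) (r : V → Tape) {t : ℕ}
    (ht : t ≤ T₀) (v : V) :
    (simulation A P T₀ q T E).history G x r t v =
      P.history G (fun _ => ()) (fun w => tapeSnd (r w)) t v := by
  induction t generalizing v with
  | zero => rfl
  | succ t ih =>
    rw [history_succ, history_succ, ih (by omega)]
    congr 3
    funext w
    rw [Protocol.action, Protocol.action, ← ih (by omega) w]
    exact if_pos (by rw [length_history]; omega)

variable (A P T₀ q T E) in
-- The simulated action and energy depend only on slots before the current block, so the device's
-- finite history may be replaced by `heard`, the record of the entire execution.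
theorem simulation_action (G : SimpleGraph V) (x : V → I) (r : V → Tape) {i : ℕ} (v : V) :
    (simulation A P T₀ q T E).action G x r (T₀ + i) v =
      subslotAction E (P.result G (fun _ => ()) (fun w => tapeSnd (r w)) T₀ v)
        (simEnergy A (x v) T₀ q (tapeFst (r v))
          (heard (simulation A P T₀ q T E) G x r v) (i / q))
        (simAction A (x v) T₀ q (tapeFst (r v))
          (heard (simulation A P T₀ q T E) G x r v) (i / q)) (i % q) := by
  set S := simulation A P T₀ q T E with hS
  have h1 : ¬ (S.history G x r (T₀ + i) v).length < T₀ := by rw [length_history]; omega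
  have h2 : ∀ k < T₀ + i / q * q,
      heardAt (S.history G x r (T₀ + i) v) k = heard S G x r v k := by
    intro k hk
    have := Nat.div_mul_le_self i q
    exact heardAt_history S G x r (by omega) v
  have h3 : S.action G x r (T₀ + i) v = subslotAction E
      (P.output () (tapeSnd (r v)) ((S.history G x r (T₀ + i) v).take T₀))
      (simEnergy A (x v) T₀ q (tapeFst (r v)) (heardAt (S.history G x r (T₀ + i) v))
        (((S.history G x r (T₀ + i) v).length - T₀) / q))
      (simAction A (x v) T₀ q (tapeFst (r v)) (heardAt (S.history G x r (T₀ + i) v))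
        (((S.history G x r (T₀ + i) v).length - T₀) / q))
      (((S.history G x r (T₀ + i) v).length - T₀) % q) := if_neg h1
  rw [h3, length_history, Nat.add_sub_cancel_left, simEnergy_congr h2, simAction_congr h2,
    take_history _ _ _ _ (Nat.le_add_right _ _), hS, simulation_history_eq _ _ _ _ _ _ _ _ _ le_rfl]
  rfl

/-- All of the first `T₀` slots are charged. Later activity lies in one of at most `E` blocks, in
the subslot of the own color or of a listed one. -/
theorem simulation_energy_le (G : SimpleGraph V) (x : V → I) (r : V → Tape) (v : V) {d : ℕ}
    (hd : ∀ u r h, (P.output u r h).2.card ≤ d) :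
    (simulation A P T₀ q T E).energy G x r (T₀ + q * T) v ≤ T₀ + E * (d + 1) := by
  classical
  set S := simulation A P T₀ q T E with hS
  set e := heard S G x r v
  set o := P.result G (fun _ => ()) (fun w => tapeSnd (r w)) T₀ v with ho
  set F := (Finset.range T).filter fun t => simEnergy A (x v) T₀ q (tapeFst (r v)) e t ≤ E ∧
    (simAction A (x v) T₀ q (tapeFst (r v)) e t).Active with hF
  have h1 : ((Finset.range (T₀ + q * T)).filter fun i => (S.action G x r i v).Active) ⊆
      Finset.range T₀ ∪ (F ×ˢ insert o.1 o.2).image fun p => T₀ + (q * p.1 + p.2) := by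
    intro i hi
    rw [Finset.mem_filter, Finset.mem_range] at hi
    rw [Finset.mem_union, Finset.mem_range]
    rcases lt_or_ge i T₀ with h | h
    · exact Or.inl h
    · obtain ⟨i, rfl⟩ := Nat.exists_eq_add_of_le h
      right
      obtain ⟨hi1, hi2⟩ := hi
      rw [simulation_action A P T₀ q T E] at hi2
      obtain ⟨h2, h3, h4⟩ := active_of_subslotAction hi2
      refine Finset.mem_image.mpr ⟨(i / q, i % q), Finset.mem_product.mpr ⟨?_, h4⟩, ?_⟩
      · exact Finset.mem_filter.mpr
          ⟨Finset.mem_range.mpr (Nat.div_lt_of_lt_mul (by omega)), h2, h3⟩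
      · simp only [Nat.div_add_mod]
  have h2 : (insert o.1 o.2).card ≤ d + 1 :=
    (Finset.card_insert_le _ _).trans (Nat.add_le_add_right (hd _ _ _) 1)
  unfold Protocol.energy
  refine (Finset.card_le_card h1).trans ((Finset.card_union_le _ _).trans ?_)
  rw [Finset.card_range]
  refine Nat.add_le_add_left (Finset.card_image_le.trans ?_) _
  rw [Finset.card_product]
  exact Nat.mul_le_mul (card_active_le E T _ _) h2

theorem incoming_eq_zero {G : SimpleGraph V} {a : V → SlotAction} {v : V}
    (h : ∀ w, G.Adj v w → (a w).send = none) : Protocol.incoming G a v = 0 := by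
  classical
  refine Multiset.eq_zero_of_forall_notMem fun m hm => ?_
  obtain ⟨w, hw, hs⟩ := (Multiset.mem_filterMap _ _).mp hm
  rw [h w (Finset.mem_filter.mp (Finset.mem_val.mp hw)).2] at hs
  simp at hs

theorem NoCD_hear_zero : NoCD.hear 0 = none := NoCD_hear_of_card_ne_one 0 (by simp)

/-- If the colors are distinct among the neighbours, then the messages heard in the subslots are
the messages sent by the neighbours. -/
theorem filterMap_subslots {G : SimpleGraph V} {o : V → ℕ × Finset ℕ} (ho : Ready G q o)
    (a : V → SlotAction) (b : ℕ → V → SlotAction)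
    (hb : ∀ j < q, ∀ v, b j v = if j = (o v).1 then ⟨(a v).send, false⟩
      else ⟨none, (a v).listen && decide (j ∈ (o v).2)⟩)
    {v : V} (hv : (a v).listen = true) :
    ((Multiset.range q).filterMap fun j => (perceive G (b j) v).join) =
      Protocol.incoming G a v := by
  classical
  set N : Finset V := Finset.univ.filter fun w => G.Adj v w with hN
  have hmem : ∀ w, w ∈ N ↔ G.Adj v w := by simp [hN]
  -- Two neighbours of `v` are at distance at most two through `v`, so their subslots differ.
  have hinj : Set.InjOn (fun w => (o w).1) N := by
    intro w hw w' hw' hww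
    by_contra hne
    exact ho.isColoring.2 w w'
      ⟨hne, Or.inr ⟨v, ((hmem w).mp hw).symm, (hmem w').mp hw'⟩⟩ hww
  have h1 : ∀ w ∈ N, (perceive G (b (o w).1) v).join = (a w).send := by
    intro w hw
    have hvw := (hmem w).mp hw
    have hq := ho.isColoring.1 w
    -- The subslot of a neighbour is not that of `v`, so `v` is free to listen even if `A` sends and
    -- listens at once.
    have hne : (o w).1 ≠ (o v).1 := ho.isColoring.2 w v ⟨hvw.ne', Or.inl hvw.symm⟩
    have hl : (b (o w).1 v).listen = true := by
      rw [hb _ hq, if_neg hne]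
      simp [hv, ho.mem v w hvw]
    have hw' : ∀ u, G.Adj v u → u ≠ w → (b (o w).1 u).send = none := by
      intro u hu huw
      rw [hb _ hq, if_neg]
      intro heq
      exact huw (hinj ((hmem u).mpr hu) hw heq.symm)
    have hws : (b (o w).1 w).send = (a w).send := by
      rw [hb _ hq, if_pos rfl]
    rw [perceive, if_pos hl]
    cases hs : (a w).send with
    | none =>
      rw [incoming_eq_zero, NoCD_hear_zero]
      · rfl
      · intro u hu
        by_cases huw : u = w
        · rw [huw, hws, hs]
        · exact hw' u hu huw
    | some m =>
      rw [incoming_eq_singleton G hvw (hws.trans hs) hw', NoCD_hear_singleton]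
      rfl
  have h2 : ∀ j ∈ Finset.range q, j ∉ N.image (fun w => (o w).1) →
      (perceive G (b j) v).join = none := by
    intro j hj hjN
    rw [perceive]
    split_ifs
    · rw [incoming_eq_zero, NoCD_hear_zero]
      · rfl
      · intro w hw
        rw [hb _ (Finset.mem_range.mp hj), if_neg]
        rintro rfl
        exact hjN (Finset.mem_image_of_mem (fun w => (o w).1) ((hmem w).mpr hw))
    · rfl
  have h3 : N.image (fun w => (o w).1) =
      (Finset.range q).filter fun j => j ∈ N.image fun w => (o w).1 := by
    ext j
    simp only [Finset.mem_filter, Finset.mem_range]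
    refine ⟨fun h => ⟨?_, h⟩, fun h => h.2⟩
    obtain ⟨w, -, rfl⟩ := Finset.mem_image.mp h
    exact ho.isColoring.1 w
  -- Subslots owned by no neighbour are silent and drop out; the others correspond bijectively to
  -- the neighbours.
  have h4 : ((Multiset.range q).filterMap fun j => (perceive G (b j) v).join) =
      (N.image fun w => (o w).1).val.filterMap fun j => (perceive G (b j) v).join := by
    rw [h3, Finset.filter_val, Multiset.filterMap_filter]
    refine multiset_filterMap_congr fun j hj => ?_
    split_ifs with h
    · rfl
    · exact h2 j hj h
  rw [h4, Finset.image_val_of_injOn hinj, Multiset.filterMap_map, Protocol.incoming]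
  exact multiset_filterMap_congr h1

/-- By induction on the slots, the reconstructed histories are those of `A`; the energy hypothesis
ensures that the budget never silences a device. -/
theorem simulation_correct {G : SimpleGraph V} {x : V → I} {r : V → Tape}
    (hP : Ready G q (P.result G (fun _ => ()) (fun w => tapeSnd (r w)) T₀))
    (hE : ∀ v, A.energy G x (fun w => tapeFst (r w)) T v ≤ E) (v : V) :
    (simulation A P T₀ q T E).result G x r (T₀ + q * T) v =
      A.result G x (fun w => tapeFst (r w)) T v := by
  classical
  set S := simulation A P T₀ q T E with hS
  -- All `t' ≤ t` are carried along because `simEnergy` counts all earlier actions.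
  have key : ∀ t ≤ T, ∀ t' ≤ t, ∀ v, simHistory A (x v) T₀ q (tapeFst (r v)) (heard S G x r v) t' =
      A.history G x (fun w => tapeFst (r w)) t' v := by
    intro t
    induction t with
    | zero =>
      intro _ t' ht' v
      obtain rfl : t' = 0 := by omega
      rfl
    | succ t ih =>
      intro ht t' ht' v
      have ih := ih (by omega)
      rcases Nat.le_succ_iff.mp ht' with h | rfl
      · exact ih t' h v
      have hact : ∀ t' ≤ t, ∀ w, simAction A (x w) T₀ q (tapeFst (r w)) (heard S G x r w) t' =
          A.action G x (fun w => tapeFst (r w)) t' w := by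
        intro t' ht' w
        rw [simAction, ih t' ht' w]
        rfl
      have hen : ∀ w, simEnergy A (x w) T₀ q (tapeFst (r w)) (heard S G x r w) t ≤ E := by
        intro w
        refine le_trans (Finset.card_le_card fun t' ht' => ?_) (hE w)
        rw [Finset.mem_filter, Finset.mem_range] at ht' ⊢
        refine ⟨by omega, ?_⟩
        rw [← hact t' (by omega) w]
        exact ht'.2
      have hb : ∀ j < q, ∀ w, S.action G x r (T₀ + t * q + j) w =
          if j = (P.result G (fun _ => ()) (fun w => tapeSnd (r w)) T₀ w).1 then
            ⟨(A.action G x (fun w => tapeFst (r w)) t w).send, false⟩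
          else ⟨none, (A.action G x (fun w => tapeFst (r w)) t w).listen &&
            decide (j ∈ (P.result G (fun _ => ()) (fun w => tapeSnd (r w)) T₀ w).2)⟩ := by
        intro j hj w
        have hdiv : (t * q + j) / q = t := by
          rw [mul_comm, Nat.mul_add_div (by omega), Nat.div_eq_of_lt hj, add_zero]
        have hmod : (t * q + j) % q = j := by
          rw [mul_comm, Nat.mul_add_mod, Nat.mod_eq_of_lt hj]
        rw [add_assoc, hS, simulation_action A P T₀ q T E, ← hS, hdiv, hmod, hact t le_rfl w,
          subslotAction, if_pos (hen w)]
      rw [simHistory, Protocol.history, ih t le_rfl v]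
      congr 2
      change (if (A.action G x (fun w => tapeFst (r w)) t v).listen = true then _ else _) =
        if (A.action G x (fun w => tapeFst (r w)) t v).listen = true then _ else _
      split_ifs with hl
      · exact congrArg some (filterMap_subslots hP _ _ hb hl)
      · rfl
  change A.output (x v) (tapeFst (r v)) (simHistory A (x v) T₀ q (tapeFst (r v))
    (heardAt (S.history G x r (T₀ + q * T) v)) T) = A.output (x v) (tapeFst (r v)) _
  rw [← key T le_rfl T le_rfl v]
  congr 1
  refine simHistory_congr fun i hi => heardAt_history S G x r ?_ v
  rwa [mul_comm] at hi

end Simulation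

/-! ## The theorem -/

namespace Protocol

variable {ch : Channel} {I O O' : Type*} [MeasurableSpace O] [MeasurableSpace O']

/-- Apply a measurable function to the outputs of a protocol. -/
def mapOutput (P : Protocol ch I O) {f : O → O'} (hf : Measurable f) : Protocol ch I O' where
  act := P.act
  output x r h := f (P.output x r h)
  measurable_act := P.measurable_act
  measurable_output x h := hf.comp (P.measurable_output x h)

theorem history_mapOutput {V : Type*} [Fintype V] (P : Protocol ch I O) {f : O → O'}
    (hf : Measurable f) (G : SimpleGraph V) (x : V → I) (r : V → Tape) (t : ℕ) :
    (P.mapOutput hf).history G x r t = P.history G x r t := by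
  induction t with
  | zero => rfl
  | succ t ih =>
    funext v
    simp only [history, ih]
    rfl

theorem result_mapOutput {V : Type*} [Fintype V] (P : Protocol ch I O) {f : O → O'}
    (hf : Measurable f) (G : SimpleGraph V) (x : V → I) (r : V → Tape) (t : ℕ) (v : V) :
    (P.mapOutput hf).result G x r t v = f (P.result G x r t v) := by
  rw [result, history_mapOutput]
  rfl

end Protocol

/-- A protocol in which all devices are idle and which takes its output from another function. -/
def idleProtocol {ch : Channel} {I O : Type*} [MeasurableSpace O] (out : I → Tape → O)
    (hout : ∀ x, Measurable (out x)) : Protocol ch I O where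
  act _ _ _ := ⟨none, false⟩
  output x r _ := out x r
  measurable_act _ _ := measurable_const
  measurable_output x _ := hout x

/-- Unites `Δ = 1` with `Δ ≥ 2`. For `Δ = 1` the time bound is zero, as `log 1 = 0`, so colors are
drawn without communication from `2 ^ c` values, and `K` absorbs this palette size. -/
theorem exists_setup (c : ℕ) : ∃ K : ℕ, 1 ≤ K ∧ ∀ n Δ : ℕ, 2 ≤ n → 1 ≤ Δ →
    ∃ (P : Protocol NoCD Unit (ℕ × Finset ℕ)) (T₀ q : ℕ), P.HalfDuplex ∧
      (T₀ : ℝ) ≤ K * (Δ * Real.log Δ * Real.log n) ∧ q ≤ K * Δ ^ 2 ∧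
      (∀ u r h, (P.output u r h).2.card ≤ K * Δ) ∧ (2 ≤ Δ → q = 2 * Δ ^ 2) ∧
      ∀ G : SimpleGraph (Fin n), IsNetwork Δ G →
        tapesMeasure (Fin n) {r | ¬ Ready G q (P.result G (fun _ => ()) r T₀)} ≤
          ENNReal.ofReal (1 / (n : ℝ) ^ c) := by
  have hpos := Nat.two_pow_pos c
  refine ⟨64 * (85 * c + 347) + 2 ^ c, by omega, fun n Δ hn hΔ => ?_⟩
  set K := 64 * (85 * c + 347) + 2 ^ c with hK
  have hK1 : 2 ≤ K := by omega
  rcases Nat.lt_or_ge Δ 2 with h | h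
  · obtain rfl : Δ = 1 := by omega
    obtain ⟨P, hP, hcard, hprob⟩ := exists_random_color_protocol c n hn
    refine ⟨P, 0, 2 ^ c, hP, by simp, by omega, fun u r h => (hcard u r h).trans (by omega),
      fun h => by omega, hprob⟩
  · obtain ⟨P, T₀, hP, hT, hcard, hprob⟩ := exists_coloring_protocol c n Δ hn h
    refine ⟨P, T₀, 2 * Δ ^ 2, hP, hT.trans ?_, Nat.mul_le_mul_right _ hK1,
      fun u r h => (hcard u r h).trans (Nat.le_mul_of_pos_left _ (by omega)), fun _ => rfl, hprob⟩
    have h1 : (64 * (85 * c + 347) : ℝ) ≤ K := by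
      rw [hK]; push_cast; linarith [pow_pos (two_pos (α := ℝ)) c]
    have h2 : 0 ≤ (Δ : ℝ) * Real.log Δ * Real.log n := by positivity
    exact mul_le_mul_of_nonneg_right h1 h2

/-- `B` need not be measurable: preimages under a measure-preserving map never gain outer measure.
-/
theorem tapesMeasure_tapeSnd_le {V : Type*} [Fintype V] {B : Set (V → Tape)} {a : ENNReal}
    (h : tapesMeasure V B ≤ a) :
    tapesMeasure V {r | (fun v => tapeSnd (r v)) ∈ B} ≤ a := by
  have h1 := (measurePreserving_tapesSnd (V := V)).measure_preimage_le B
  exact h1.trans h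

theorem mainTheorem7 (c : ℕ) :
    ∃ C : ℝ, 0 < C ∧ ∀ n Δ : ℕ,
      -- the coloring protocol `P`, which takes `T₀` slots and does not depend on `A`
      ∃ (P : Protocol NoCD Unit ℕ) (T₀ : ℕ),
        P.HalfDuplex ∧
        (T₀ : ℝ) ≤ C * (Δ * Real.log Δ * Real.log n) ∧
        (2 ≤ Δ → ∀ G : SimpleGraph (Fin n), IsNetwork Δ G →
          tapesMeasure (Fin n)
              {r | ¬ IsColoring (plusSquare G) (2 * Δ ^ 2) (P.result G (fun _ => ()) r T₀)}
            ≤ ENNReal.ofReal (1 / (n : ℝ) ^ c)) ∧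
        -- every (possibly full-duplex) LOCAL algorithm `A` with time `T` and energy `E`
        ∀ (I O : Type*) [MeasurableSpace O] (A : Protocol LOCAL I O) (T E : ℕ),
          -- is simulated by a No-CD protocol `S` with time `T'`, every device of which uses the
          -- part `ρ` of its random bits for `A` and the independent part `σ` for `P`
          ∃ (S : Protocol NoCD I O) (T' : ℕ) (ρ σ : Tape → Tape),
            S.HalfDuplex ∧
            MeasurePreserving (fun r => (ρ r, σ r)) tapeMeasure (tapeMeasure.prod tapeMeasure) ∧
            -- the first `T₀` slots of `S` are an execution of `P`
            T₀ ≤ T' ∧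
            (∀ x r h, h.length < T₀ → S.act x r h = P.act () (σ r) h) ∧
            -- time
            (T' : ℝ) ≤ C * ((Δ : ℝ) ^ 2 * T + Δ * Real.log Δ * Real.log n) ∧
            ∀ (G : SimpleGraph (Fin n)) (x : Fin n → I), IsNetwork Δ G →
              -- energy
              (∀ r v, (S.energy G x r T' v : ℝ)
                ≤ C * (Δ * (E + Real.log Δ * Real.log n))) ∧
              -- with high probability, all outputs are those of `A`
              tapesMeasure (Fin n)
                  {r | (∀ v, A.energy G x (fun w => ρ (r w)) T v ≤ E) ∧
                    ∃ v, S.result G x r T' v ≠ A.result G x (fun w => ρ (r w)) T v}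
                ≤ ENNReal.ofReal (1 / (n : ℝ) ^ c) := by
  obtain ⟨K, hK, hsetup⟩ := exists_setup c
  have hK0 : (1 : ℝ) ≤ K := by exact_mod_cast hK
  -- The factor `2` pays for the subslot of the own color: `K * Δ + 1 ≤ 2 * (K * Δ)`.
  refine ⟨2 * K, by positivity, fun n Δ => ?_⟩
  have hlog : 0 ≤ (Δ : ℝ) * Real.log Δ * Real.log n := by positivity
  by_cases htriv : n ≤ 1 ∨ Δ = 0
  -- Here a network has exactly one vertex, so the allowed error `1 / n ^ c` is `1` and idle
  -- protocols suffice.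
  · have hone : ∀ G : SimpleGraph (Fin n), IsNetwork Δ G →
        (1 : ENNReal) ≤ ENNReal.ofReal (1 / (n : ℝ) ^ c) := by
      intro G hG
      have h1 := hG.card_le
      have h2 : 0 < n := by
        obtain ⟨v⟩ := hG.1.nonempty
        exact v.pos
      obtain rfl : n = 1 := by
        rcases htriv with h | rfl <;> omega
      simp
    refine ⟨idleProtocol (fun _ _ => 0) fun _ => measurable_const, 0, ?_, ?_, ?_, ?_⟩
    · intro x r h; simp [idleProtocol]
    · push_cast; positivity
    · exact fun _ G hG => prob_le_one.trans (hone G hG)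
    · intro I O _ A T E
      refine ⟨idleProtocol (fun x r => A.output x (tapeFst r) []) fun x =>
        (A.measurable_output x []).comp measurable_tapeFst, 0, tapeFst, tapeSnd, ?_,
        measurePreserving_tapeSplit, le_rfl, fun _ _ _ _ => rfl, ?_, fun G x hG => ⟨?_, ?_⟩⟩
      · intro x r h; simp [idleProtocol]
      · push_cast; positivity
      · intro r v
        simp only [Protocol.energy, Finset.range_zero, Finset.filter_empty, Finset.card_empty]
        push_cast
        positivity
      · exact prob_le_one.trans (hone G hG)
  · push Not at htriv
    have hΔ1 : 1 ≤ Δ := Nat.one_le_iff_ne_zero.mpr htriv.2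
    obtain ⟨P, T₀, q, hP, hT₀, hq, hcard, hq2, hprob⟩ := hsetup n Δ htriv.1 hΔ1
    have hT₀' : (T₀ : ℝ) ≤ 2 * K * (Δ * Real.log Δ * Real.log n) := by
      have := mul_nonneg (zero_le_one.trans hK0) hlog
      linarith
    refine ⟨P.mapOutput measurable_fst, T₀, hP, hT₀', fun h2 G hG => ?_, ?_⟩
    · refine (measure_mono ?_).trans (hprob G hG)
      intro r hr hR
      refine hr ?_
      have h3 := hR.isColoring
      rw [hq2 h2] at h3
      have h4 : (P.mapOutput measurable_fst).result G (fun _ => ()) r T₀ =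
          fun v => (P.result G (fun _ => ()) r T₀ v).1 :=
        funext fun v => P.result_mapOutput measurable_fst G _ r T₀ v
      rwa [h4]
    · intro I O _ A T E
      refine ⟨simulation A P T₀ q T E, T₀ + q * T, tapeFst, tapeSnd, simulation_halfDuplex hP,
        measurePreserving_tapeSplit, Nat.le_add_right _ _, fun x r h hh => if_pos hh, ?_,
        fun G x hG => ⟨fun r v => ?_, ?_⟩⟩
      · have h1 : (q : ℝ) ≤ K * Δ ^ 2 := by exact_mod_cast hq
        have h2 : (q : ℝ) * T ≤ K * Δ ^ 2 * T := mul_le_mul_of_nonneg_right h1 (by positivity)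
        have h3 : (0 : ℝ) ≤ K * Δ ^ 2 * T := by positivity
        push_cast
        linarith
      · have h1 := simulation_energy_le (A := A) (q := q) (T₀ := T₀) (T := T) (E := E) G x r v hcard
        have h2 : ((simulation A P T₀ q T E).energy G x r (T₀ + q * T) v : ℝ) ≤
            T₀ + E * (K * Δ + 1) := by exact_mod_cast h1
        have h3 : (1 : ℝ) ≤ K * Δ := by exact_mod_cast Nat.mul_pos hK hΔ1
        have h4 : (E : ℝ) * (K * Δ + 1) ≤ E * (2 * (K * Δ)) :=
          mul_le_mul_of_nonneg_left (by linarith) (by positivity)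
        linarith
      · refine (measure_mono fun r hr => ?_).trans (tapesMeasure_tapeSnd_le (hprob G hG))
        intro hR
        obtain ⟨hE, v, hv⟩ := hr
        exact hv (simulation_correct hR hE v)
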